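/- Let $n,k\ge 1$ be integers and $s\in(0,1)$. Let $\omega\subset\mathbb{R}^n$ be a bounded Lipschitz domain and $B\subset\mathbb{R}^k$ a bounded, open, convex neighbourhood of the origin; points of $\mathbb{R}^{n+k}=\mathbb{R}^n\times\mathbb{R}^k$ are written $(x,t)$. For $u\in L^2(\mathbb{R}^d)$ real-valued put $$\mathcal E^s_d(u)=\int_{\mathbb{R}^d}|\xi|^{2s}\,|\mathcal F_d[u](\xi)|^2\,d\xi\in[0,\infty],\qquad \mathcal F_d[u](\xi)=(2\pi)^{-d/2}\int_{\mathbb{R}^d}e^{-iz\cdot\xi}u(z)\,dz$$ (with $\mathcal F_d$ extended to $L^2$), and for $U\subset\mathbb{R}^d$ open let $$\widetilde H^s(U)=\{u\in L^2(\mathbb{R}^d):\ \mathcal E^s_d(u)<\infty,\ u=0\text{ a.e. on }\mathbb{R}^d\setminus\overline U\},\qquad \|u\|^2=\mathcal E^s_d(u)+\|u\|_{L^2}^2 .$$ For $v\in\widetilde H^s(\omega\times B)$ and $\ell>0$ define $$\rho(v)(x)=\frac1{|B|}\int_{B}v(x,t)\,dt,\qquad \mathscr E_\ell(v)=\frac{1}{|\ell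 B|}\,\mathcal E^s_{n+k}(\breve v_\ell),\qquad \breve v_\ell(x,t)=v\Big(x,\frac t\ell\Big).$$ Then $\rho$ maps $\widetilde H^s(\omega\times B)$ into $\widetilde H^s(\omega)$. Let $\sigma_\rho$ be the weak-averaged topology on $\widetilde H^s(\omega\times B)$, that is, the weakest topology for which $T\circ\rho$ is continuous for every $T$ in the topological dual of $\widetilde H^s(\omega)$. The functionals $\mathscr E_\ell$ sequentially $\Gamma$-converge to $\mathcal E^s_n\circ\rho$ with respect to $\sigma_\rho$ as $\ell\to\infty$. Precisely, for every sequence $\ell_h\in(0,\infty)$ with $\ell_h\to\infty$ and every $v\in\widetilde H^s(\omega\times B)$: i) if $v_h\in\widetilde H^s(\omega\times B)$ and $v_h\to v$ in $\sigma_\rho$, then $\mathcal E^s_n(\rho(v))\le\liminf_{h\to\infty}\mathscr E_{\ell_h}(v_h)$; ii) there is a sequence $\overline v_h\in\widetilde H^s(\omega\times B)$ with $\overline v_h\to v$ in $\sigma_\rho$ and $\limsup_{h\to\infty}\mathscr E_{\ell_h}(\overline v_h)\le\mathcal E^s_n(\rho(v))$. -/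

import Mathlib

open MeasureTheory Filter Topology
open scoped ENNReal Real Pointwise FourierTransform RealInnerProductSpace

noncomputable section

namespace FracDim

/-- `ℝᵈ` with its Euclidean norm. -/
abbrev E (d : ℕ) : Type := EuclideanSpace ℝ (Fin d)

/-- `ℝⁿ⁺ᵏ ≡ ℝⁿ × ℝᵏ` with its Euclidean norm; points are pairs `(x, t)`. -/
abbrev EE (n k : ℕ) : Type := WithLp 2 (E n × E k)

/-- Real-valued (classes of) square integrable functions on `V`, for the Lebesgue measure. -/
abbrev L2 (V : Type) [NormedAddCommGroup V] [InnerProductSpace ℝ V] [FiniteDimensional ℝ V]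
    [MeasurableSpace V] [BorelSpace V] : Type :=
  Lp ℝ 2 (volume : Measure V)

section Spaces

variable {V : Type} [NormedAddCommGroup V] [InnerProductSpace ℝ V] [FiniteDimensional ℝ V]
  [MeasurableSpace V] [BorelSpace V]

/-- The `L²` Fourier transform of a real-valued `L²` function, as an `ℝ`-linear map. It is
Mathlib's, the extension by density of `û(ξ) = ∫ exp(-2πi z⬝ξ) u(z) dz`. -/
def fourierL2 : L2 V →ₗ[ℝ] Lp ℂ 2 (volume : Measure V) :=
  ((Lp.fourierTransformₗᵢ V ℂ).toLinearEquiv.toLinearMap.restrictScalars ℝ).comp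
    (ContinuousLinearMap.compLpₗ 2 (volume : Measure V) Complex.ofRealCLM)

/-- The quadratic form `𝓔ˢ(u) = ⟨(-Δ)ˢ u, u⟩ = ∫ |ξ|²ˢ |𝓕[u](ξ)|² dξ ∈ [0, ∞]`, where
`𝓕[u](ξ) = (2π)^(-d/2) ∫ exp(-i z⬝ξ) u(z) dz`. Since `𝓕[u](ξ) = (2π)^(-d/2) û(ξ / 2π)`, the change
of variables `ξ = 2πη` turns it into the integral below. -/
def energy (s : ℝ) (u : L2 V) : ℝ≥0∞ :=
  ∫⁻ η : V, ENNReal.ofReal ((2 * π * ‖η‖) ^ (2 * s)) * ‖(fourierL2 u : V → ℂ) η‖ₑ ^ 2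

/-- The Fourier multiplier side of `(-Δ)^(s/2) u`, as a function: its `L²` norm squared is
`𝓔ˢ(u)`. -/
def halfSymbol (s : ℝ) (u : L2 V) : V → ℂ :=
  fun η => ((2 * π * ‖η‖) ^ s : ℝ) • (fourierL2 u : V → ℂ) η

theorem aestronglyMeasurable_halfSymbol (s : ℝ) (u : L2 V) :
    AEStronglyMeasurable (halfSymbol s u) (volume : Measure V) := by
  have h : Measurable fun η : V => (2 * π * ‖η‖) ^ s := by fun_prop
  exact h.aestronglyMeasurable.smul (Lp.aestronglyMeasurable (fourierL2 u))

theorem eLpNorm_halfSymbol_sq (s : ℝ) (u : L2 V) :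
    eLpNorm (halfSymbol s u) 2 (volume : Measure V) ^ 2 = energy s u := by
  have h := eLpNorm_nnreal_pow_eq_lintegral (f := halfSymbol s u) (μ := (volume : Measure V))
    (p := 2) (by norm_num)
  simp only [NNReal.coe_ofNat, ENNReal.coe_ofNat, ENNReal.rpow_ofNat] at h
  rw [h, energy]
  refine lintegral_congr fun η => ?_
  have h0 : 0 ≤ 2 * π * ‖η‖ := by positivity
  rw [halfSymbol, enorm_smul, mul_pow, Real.enorm_eq_ofReal (by positivity),
    ← ENNReal.ofReal_pow (by positivity), mul_comm 2 s, Real.rpow_mul h0, Real.rpow_ofNat]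

theorem memLp_halfSymbol_iff (s : ℝ) (u : L2 V) :
    MemLp (halfSymbol s u) 2 (volume : Measure V) ↔ energy s u < ⊤ := by
  rw [← eLpNorm_halfSymbol_sq, MemLp, and_iff_right (aestronglyMeasurable_halfSymbol s u)]
  simp [lt_top_iff_ne_top]

theorem halfSymbol_add (s : ℝ) (u v : L2 V) :
    halfSymbol s (u + v) =ᵐ[volume] halfSymbol s u + halfSymbol s v := by
  filter_upwards [Lp.coeFn_add (fourierL2 u) (fourierL2 v)] with η h
  simp only [halfSymbol, map_add, Pi.add_apply, h, smul_add]

theorem halfSymbol_smul (s c : ℝ) (u : L2 V) :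
    halfSymbol s (c • u) =ᵐ[volume] c • halfSymbol s u := by
  filter_upwards [Lp.coeFn_smul c (fourierL2 u)] with η h
  simp only [halfSymbol, map_smul, Pi.smul_apply, h]
  rw [smul_comm]

/-- `H̃ˢ(U) = {u ∈ Hˢ(V) | u = 0 a.e. outside the closure of U}`, where
`Hˢ(V) = {u ∈ L²(V) | (-Δ)^(s/2) u ∈ L²(V)}`, as a linear subspace of `L²(V)`. -/
def tildeHSub (s : ℝ) (U : Set V) : Submodule ℝ (L2 V) where
  carrier := {u | energy s u < ⊤ ∧ ∀ᵐ z : V, z ∉ closure U → u z = 0}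
  zero_mem' := by
    refine ⟨(memLp_halfSymbol_iff s 0).1 ?_, ?_⟩
    · refine MemLp.ae_eq ?_ (MemLp.zero (ε := ℂ))
      filter_upwards [Lp.coeFn_zero ℂ 2 (volume : Measure V)] with η h
      rw [halfSymbol, map_zero, h]
      simp
    · filter_upwards [Lp.coeFn_zero ℝ 2 (volume : Measure V)] with z h _
      rw [h, Pi.zero_apply]
  add_mem' := by
    rintro u v ⟨hu, hu'⟩ ⟨hv, hv'⟩
    refine ⟨(memLp_halfSymbol_iff s _).1 ?_, ?_⟩
    · exact (((memLp_halfSymbol_iff s u).2 hu).add ((memLp_halfSymbol_iff s v).2 hv)).ae_eq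
        (halfSymbol_add s u v).symm
    · filter_upwards [hu', hv', Lp.coeFn_add u v] with z h1 h2 h3 hz
      rw [h3, Pi.add_apply, h1 hz, h2 hz, add_zero]
  smul_mem' := by
    rintro c u ⟨hu, hu'⟩
    refine ⟨(memLp_halfSymbol_iff s _).1 ?_, ?_⟩
    · exact (((memLp_halfSymbol_iff s u).2 hu).const_smul c).ae_eq (halfSymbol_smul s c u).symm
    · filter_upwards [hu', Lp.coeFn_smul c u] with z h1 h3 hz
      rw [h3, Pi.smul_apply, h1 hz, smul_zero]

/-- The space `H̃ˢ(U)`; it carries the norm of `Hˢ`, `‖u‖² = 𝓔ˢ(u) + ‖u‖²_{L²}` (see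
`TildeH.norm_sq`). A type of its own, so that the `L²` norm of the subspace is not in force. -/
def TildeH (s : ℝ) (U : Set V) : Type := ↥(tildeHSub s U)

namespace TildeH

variable {s : ℝ} {U : Set V}

instance : AddCommGroup (TildeH s U) := inferInstanceAs (AddCommGroup ↥(tildeHSub s U))

instance : Module ℝ (TildeH s U) := inferInstanceAs (Module ℝ ↥(tildeHSub s U))

/-- The underlying `L²` function of an element of `H̃ˢ(U)`. -/
def toL2 : TildeH s U →ₗ[ℝ] L2 V := (tildeHSub s U).subtype

/-- The pair `(u, |ξ|ˢ 𝓕[u])` in `L² × L²`, from which `H̃ˢ(U)` takes its norm. -/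
def graph : TildeH s U →ₗ[ℝ] WithLp 2 (L2 V × Lp ℂ 2 (volume : Measure V)) where
  toFun u := WithLp.toLp 2 (toL2 u, ((memLp_halfSymbol_iff s (toL2 u)).2 u.2.1).toLp _)
  map_add' u v := by
    rw [← WithLp.toLp_add, Prod.mk_add_mk, ← MemLp.toLp_add]
    have h2 := MemLp.toLp_congr ((memLp_halfSymbol_iff s (toL2 (u + v))).2 (u + v).2.1)
      (((memLp_halfSymbol_iff s (toL2 u)).2 u.2.1).add ((memLp_halfSymbol_iff s (toL2 v)).2 v.2.1))
      (halfSymbol_add s (toL2 u) (toL2 v))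
    rw [h2, map_add]
  map_smul' c u := by
    rw [RingHom.id_apply, ← WithLp.toLp_smul, Prod.smul_mk, ← MemLp.toLp_const_smul]
    have h2 := MemLp.toLp_congr ((memLp_halfSymbol_iff s (toL2 (c • u))).2 (c • u).2.1)
      (((memLp_halfSymbol_iff s (toL2 u)).2 u.2.1).const_smul c)
      (halfSymbol_smul s c (toL2 u))
    rw [h2, map_smul]

theorem graph_injective : Function.Injective (graph (s := s) (U := U)) := by
  intro u v h
  exact Subtype.ext (congrArg (fun w => w.fst) h)

instance : NormedAddCommGroup (TildeH s U) :=
  NormedAddCommGroup.induced (TildeH s U) _ graph graph_injective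

instance : NormedSpace ℝ (TildeH s U) := NormedSpace.induced ℝ (TildeH s U) _ graph

theorem norm_sq (u : TildeH s U) :
    ‖u‖ ^ 2 = (energy s (toL2 u)).toReal + ‖toL2 u‖ ^ 2 := by
  change ‖graph u‖ ^ 2 = _
  rw [WithLp.prod_norm_sq_eq_of_L2, ← eLpNorm_halfSymbol_sq, ENNReal.toReal_pow, add_comm]
  congr 2
  exact Lp.norm_toLp (halfSymbol s (toL2 u)) ((memLp_halfSymbol_iff s (toL2 u)).2 u.2.1)

end TildeH

/-- Open sets with Lipschitz boundary: near each boundary point there is a direction `ν` such that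
`U` is locally the strict epigraph, in the direction `ν`, of a Lipschitz function of the component
orthogonal to `ν`. (Connectedness is not demanded.) -/
def IsLipschitzDomain (U : Set V) : Prop :=
  IsOpen U ∧ ∀ z ∈ frontier U, ∃ ν : V, ‖ν‖ = 1 ∧ ∃ (K : NNReal) (g : V → ℝ), LipschitzWith K g ∧
    ∀ᶠ y in 𝓝 z, (y ∈ U ↔ g (y - ⟪ν, y⟫ • ν) < ⟪ν, y⟫)

theorem memLp_comp_linearEquiv (L : V ≃ₗ[ℝ] V) (v : L2 V) :
    MemLp (fun z => v (L z)) 2 (volume : Measure V) := by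
  have hmap := Measure.map_linearMap_addHaar_eq_smul_addHaar (volume : Measure V)
    (f := L.toLinearMap) L.isUnit_det'.ne_zero
  have hLm : Measurable L := L.toLinearMap.continuous_of_finiteDimensional.measurable
  have h2 : MemLp v 2 (Measure.map L.toLinearMap (volume : Measure V)) := by
    rw [hmap]
    exact (Lp.memLp v).smul_measure ENNReal.ofReal_ne_top
  exact MemLp.comp_of_map h2 hLm.aemeasurable

end Spaces

section Averages

variable {n k : ℕ}

/-- The cylinder `ω × B` in `ℝⁿ⁺ᵏ`. -/
def cyl (ω : Set (E n)) (B : Set (E k)) : Set (EE n k) := {z | z.fst ∈ ω ∧ z.snd ∈ B}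

theorem memLp_dilate {ℓ : ℝ} (hℓ : 0 < ℓ) (v : L2 (EE n k)) :
    MemLp (fun z : EE n k => v (WithLp.toLp 2 (z.fst, ℓ⁻¹ • z.snd))) 2 volume := by
  let L : EE n k ≃ₗ[ℝ] EE n k :=
    (WithLp.linearEquiv 2 ℝ (E n × E k)).trans
      (((LinearEquiv.refl ℝ (E n)).prodCongr
        (LinearEquiv.smulOfNeZero ℝ (E k) ℓ⁻¹ (inv_ne_zero hℓ.ne'))).trans
        (WithLp.linearEquiv 2 ℝ (E n × E k)).symm)
  exact memLp_comp_linearEquiv L v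

/-- The dilation `v̆_ℓ(x, t) = v(x, t / ℓ)`. -/
def dilate {ℓ : ℝ} (hℓ : 0 < ℓ) (v : L2 (EE n k)) : L2 (EE n k) := (memLp_dilate hℓ v).toLp _

/-- The rescaled energy `𝓔_ℓ(v) = |B_ℓ|⁻¹ 𝓔ˢ(v̆_ℓ)`, where `B_ℓ = ℓ B`. -/
def rescaledEnergy (s : ℝ) (B : Set (E k)) {ℓ : ℝ} (hℓ : 0 < ℓ) (v : L2 (EE n k)) : ℝ≥0∞ :=
  (volume (ℓ • B))⁻¹ * energy s (dilate hℓ v)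

theorem memLp_average (B : Set (E k)) (v : L2 (EE n k)) :
    MemLp (fun x : E n => ⨍ t in B, v (WithLp.toLp 2 (x, t))) 2 volume := by
  by_cases hB : volume B = ⊤
  · simp [average_eq, measureReal_def, hB]
  set μ : Measure (E k) := (volume : Measure (E k)).restrict B with hμ
  have : IsFiniteMeasure μ := ⟨by simpa [hμ] using lt_top_iff_ne_top.2 hB⟩
  have hw : MemLp (fun p : E n × E k => v (WithLp.toLp 2 p)) 2
      ((volume : Measure (E n)).prod μ) := by
    refine ((Lp.memLp v).comp_measurePreserving
      (WithLp.volume_preserving_toLp (U := E n) (V := E k))).mono_measure ?_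
    rw [Measure.volume_eq_prod]
    exact Measure.prod_mono le_rfl Measure.restrict_le_self
  have hint : MemLp (fun x : E n => ∫ t, v (WithLp.toLp 2 (x, t)) ∂μ) 2 volume := by
    refine ⟨hw.1.integral_prod_right', ?_⟩
    have hsq : ∫⁻ x : E n, ∫⁻ t, ‖v (WithLp.toLp 2 (x, t))‖ₑ ^ 2 ∂μ < ⊤ := by
      rw [lintegral_lintegral (f := fun x t => ‖v (WithLp.toLp 2 (x, t))‖ₑ ^ 2)
        (hw.1.enorm.pow_const 2)]
      have h := (eLpNorm_lt_top_iff_lintegral_rpow_enorm_lt_top (by norm_num) (by norm_num)).1 hw.2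
      simpa using h
    have hle : ∀ᵐ x : E n, ‖∫ t, v (WithLp.toLp 2 (x, t)) ∂μ‖ₑ ^ 2 ≤
        μ Set.univ * ∫⁻ t, ‖v (WithLp.toLp 2 (x, t))‖ₑ ^ 2 ∂μ := by
      filter_upwards [hw.1.prodMk_left] with x hx
      have h1 := enorm_integral_le_lintegral_enorm (μ := μ) (fun t => v (WithLp.toLp 2 (x, t)))
      have h2 := ENNReal.lintegral_mul_le_Lp_mul_Lq μ Real.HolderConjugate.two_two
        (f := fun _ => 1) (g := fun t => ‖v (WithLp.toLp 2 (x, t))‖ₑ) aemeasurable_const hx.enorm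
      simp only [Pi.mul_apply, one_mul, ENNReal.one_rpow, lintegral_one] at h2
      refine (pow_le_pow_left' (h1.trans h2) 2).trans_eq ?_
      rw [mul_pow, ← ENNReal.rpow_natCast, ← ENNReal.rpow_natCast, ← ENNReal.rpow_mul,
        ← ENNReal.rpow_mul]
      norm_num
    rw [eLpNorm_lt_top_iff_lintegral_rpow_enorm_lt_top (by norm_num) (by norm_num)]
    simp only [ENNReal.toReal_ofNat, ENNReal.rpow_ofNat]
    refine (lintegral_mono_ae hle).trans_lt ?_
    rw [lintegral_const_mul' _ _ (measure_ne_top μ _)]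
    exact ENNReal.mul_lt_top (measure_lt_top μ _) hsq
  simp only [average_eq]
  exact hint.const_smul (μ.real Set.univ)⁻¹

/-- The averaging operator `ρ(v)(x) = ⨍_B v(x, t) dt`, from `L²(ℝⁿ⁺ᵏ)` to `L²(ℝⁿ)`. -/
def averageL2 (B : Set (E k)) (v : L2 (EE n k)) : L2 (E n) := (memLp_average B v).toLp _

end Averages

/-- The weakest topology on `X` making `T ∘ ρ` continuous for each `T` in the dual of `Y`. -/
abbrev weakAveraged {X Y : Type} [NormedAddCommGroup Y] [NormedSpace ℝ Y] (ρ : X → Y) :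
    TopologicalSpace X :=
  ⨅ T : StrongDual ℝ Y, TopologicalSpace.induced (fun v => T (ρ v)) inferInstance

/-- `J` is the (sequential) `Γ`-limit of the sequence `F` for the topology `σ`. -/
def IsSeqGammaLimit {X : Type} (σ : TopologicalSpace X) (F : ℕ → X → EReal) (J : X → EReal) :
    Prop :=
  (∀ (v : X) (w : ℕ → X), Tendsto w atTop (@nhds X σ v) →
    J v ≤ liminf (fun h => F h (w h)) atTop) ∧
  ∀ v : X, ∃ w : ℕ → X, Tendsto w atTop (@nhds X σ v) ∧
    limsup (fun h => F h (w h)) atTop ≤ J v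

end FracDim

end

/-! Lower bound. Averaging over `B` is pairing in `t` with `ψ = |B|⁻¹ 1_B`, and `‖ψ‖² = |B|⁻¹`. By
Parseval in `t`, the Fourier transform of `ρ(v)` at `ξ` is the pairing of `𝓕ψ` with `𝓕v(ξ, ·)`.
Cauchy–Schwarz and `|ξ| ≤ |(ξ, τ)|` then give `𝓔(ρ v) ≤ |B|⁻¹ 𝓔(v)` (`energy_average_le`). Since the
average over `ℓB` of the dilated function is again `ρ(v)`, this reads `𝓔(ρ v) ≤ 𝓔_ℓ(v)` for every
`ℓ`. The liminf inequality follows from weak lower semicontinuity of the energy on `L²`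
(`energy_le_liminf`).

Recovery. Put `u = ρ(v)` and take `u ⊗ φ` with a smooth cutoff `φ` of `B`; the indicator of `B`
itself may have infinite energy. Since `|(ξ, τ)|^(2s) ≤ |ξ|^(2s) + |τ|^(2s)` for `s ≤ 1`, and the
energy in `t` scales like `ℓ^(k-2s)` against the volume `ℓ^k |B|`, `𝓔_ℓ(u ⊗ φ) ≤ 𝓔(u) + C(u, φ)
ℓ^(-2s)` (`rescaledEnergy_tensor_le`). The average of `u ⊗ φ` is a scalar multiple of `u`; a
diagonal choice lets `φ` tend to the indicator slowly enough to keep the error vanishing.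

The lower bound uses only functionals continuous on `L²`, while the recovery sequence converges
against all those continuous for the norm of `Hˢ`; the argument therefore covers the weak-averaged
topology of either norm. -/

noncomputable section

namespace FracDim

/-! ### The `L²` Fourier transform on `L¹ ∩ L²` -/

section FourierIntegral

variable {V : Type} [NormedAddCommGroup V] [InnerProductSpace ℝ V] [FiniteDimensional ℝ V]
  [MeasurableSpace V] [BorelSpace V]

/-- On `L¹ ∩ L²` the `L²` Fourier transform is given by the Fourier integral. -/
theorem coeFn_fourier_toLp {f : V → ℂ} (hf1 : Integrable f) (hf2 : MemLp f 2 volume) :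
    (𝓕 (hf2.toLp f) : Lp ℂ 2 (volume : Measure V)) =ᵐ[volume] 𝓕 f := by
  have hcont : Continuous (𝓕 f) :=
    VectorFourier.fourierIntegral_continuous Real.continuous_fourierChar
      (by exact continuous_inner) hf1
  refine ae_eq_of_integral_contDiff_smul_eq
    ((Lp.memLp _).locallyIntegrable (by norm_num)) hcont.locallyIntegrable fun g hg hgc => ?_
  have hgc' : HasCompactSupport (fun x => (g x : ℂ)) := hgc.comp_left Complex.ofReal_zero
  have hg' : ContDiff ℝ (⊤ : ℕ∞) fun x => (g x : ℂ) := Complex.ofRealCLM.contDiff.comp hg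
  set G : SchwartzMap V ℂ := hgc'.toSchwartzMap hg' with hG
  have hGc : ∀ x, G x = (g x : ℂ) := fun x => rfl
  -- The `L²` transform is also the distributional one, so it can be moved onto the test function
  -- `G`; the multiplication formula (`h3`) moves it back onto `f` as a Fourier integral.
  have h1 := congrArg (fun T => T G)
    (Lp.fourier_toTemperedDistribution_eq (hf2.toLp f : Lp ℂ 2 (volume : Measure V)))
  simp only [TemperedDistribution.fourier_apply, Lp.toTemperedDistribution_apply] at h1
  have h2 : ∫ x, (𝓕 G) x • (hf2.toLp f : V → ℂ) x = ∫ x, (𝓕 G) x • f x :=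
    integral_congr_ae (by filter_upwards [hf2.coeFn_toLp] with x hx; rw [hx])
  have h3 : ∫ x, (𝓕 G) x • f x = ∫ x, G x • (𝓕 f) x :=
    (VectorFourier.integral_fourierIntegral_smul_eq_flip (L := innerₗ V)
      Real.continuous_fourierChar (by exact continuous_inner) G.integrable hf1).trans
      (by rw [flip_innerₗ]; rfl)
  rw [h2, h3] at h1
  simpa [hGc] using h1.symm

end FourierIntegral

/-! ### Tensor products and their Fourier transforms -/

section Tensor

variable {U V : Type} [NormedAddCommGroup U] [InnerProductSpace ℝ U] [FiniteDimensional ℝ U]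
  [MeasurableSpace U] [BorelSpace U]
  [NormedAddCommGroup V] [InnerProductSpace ℝ V] [FiniteDimensional ℝ V]
  [MeasurableSpace V] [BorelSpace V]

theorem lintegral_withLp_prod (F : U × V → ℝ≥0∞) :
    ∫⁻ z : WithLp 2 (U × V), F z.ofLp = ∫⁻ p : U × V, F p :=
  (WithLp.volume_preserving_ofLp U V).lintegral_comp_emb
    (MeasurableEquiv.toLp 2 (U × V)).symm.measurableEmbedding F

theorem integral_withLp_prod {X : Type} [NormedAddCommGroup X] [NormedSpace ℝ X]
    (F : U × V → X) :
    ∫ z : WithLp 2 (U × V), F z.ofLp = ∫ p : U × V, F p :=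
  (WithLp.volume_preserving_ofLp U V).integral_comp
    (MeasurableEquiv.toLp 2 (U × V)).symm.measurableEmbedding F

theorem integrable_withLp_prod {X : Type} [NormedAddCommGroup X] {F : U × V → X} :
    Integrable (fun z : WithLp 2 (U × V) => F z.ofLp) ↔ Integrable F :=
  (WithLp.volume_preserving_ofLp U V).integrable_comp_emb
    (MeasurableEquiv.toLp 2 (U × V)).symm.measurableEmbedding

theorem quasiMeasurePreserving_fst :
    Measure.QuasiMeasurePreserving (fun z : WithLp 2 (U × V) => z.fst) volume volume :=
  Measure.quasiMeasurePreserving_fst.comp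
    (WithLp.volume_preserving_ofLp U V).quasiMeasurePreserving

theorem quasiMeasurePreserving_snd :
    Measure.QuasiMeasurePreserving (fun z : WithLp 2 (U × V) => z.snd) volume volume :=
  Measure.quasiMeasurePreserving_snd.comp
    (WithLp.volume_preserving_ofLp U V).quasiMeasurePreserving

theorem lintegral_withLp_mul {f : U → ℝ≥0∞} {g : V → ℝ≥0∞}
    (hf : AEMeasurable f volume) (hg : AEMeasurable g volume) :
    ∫⁻ z : WithLp 2 (U × V), f z.fst * g z.snd = (∫⁻ x, f x) * ∫⁻ t, g t :=
  (lintegral_withLp_prod fun p => f p.1 * g p.2).trans (lintegral_prod_mul hf hg)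

variable {𝕜 : Type} [RCLike 𝕜]

theorem eLpNorm_two_sq {α : Type} [MeasurableSpace α] {μ : Measure α} {X : Type}
    [NormedAddCommGroup X] (f : α → X) :
    eLpNorm f 2 μ ^ 2 = ∫⁻ x, ‖f x‖ₑ ^ 2 ∂μ := by
  have h := eLpNorm_nnreal_pow_eq_lintegral (f := f) (μ := μ) (p := 2) (by norm_num)
  simpa using h

theorem eLpNorm_tensor {f : U → 𝕜} {g : V → 𝕜} (hf : AEStronglyMeasurable f volume)
    (hg : AEStronglyMeasurable g volume) :
    eLpNorm (fun z : WithLp 2 (U × V) => f z.fst * g z.snd) 2 volume =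
      eLpNorm f 2 volume * eLpNorm g 2 volume := by
  refine (ENNReal.pow_right_strictMono two_ne_zero).injective ?_
  simp only [mul_pow, eLpNorm_two_sq, enorm_mul]
  exact lintegral_withLp_mul (f := fun x => ‖f x‖ₑ ^ 2) (g := fun x => ‖g x‖ₑ ^ 2)
    (hf.enorm.pow_const 2) (hg.enorm.pow_const 2)

theorem memLp_tensor {f : U → 𝕜} {g : V → 𝕜} (hf : MemLp f 2 volume) (hg : MemLp g 2 volume) :
    MemLp (fun z : WithLp 2 (U × V) => f z.fst * g z.snd) 2 volume := by
  refine ⟨?_, ?_⟩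
  · exact (hf.1.comp_quasiMeasurePreserving quasiMeasurePreserving_fst).mul
      (hg.1.comp_quasiMeasurePreserving quasiMeasurePreserving_snd)
  · rw [eLpNorm_tensor hf.1 hg.1]
    exact ENNReal.mul_lt_top hf.2 hg.2

/-- The tensor product `(f ⊗ g)(x, t) = f(x) g(t)` of two square integrable functions. -/
def tensor (f : Lp 𝕜 2 (volume : Measure U)) (g : Lp 𝕜 2 (volume : Measure V)) :
    Lp 𝕜 2 (volume : Measure (WithLp 2 (U × V))) :=
  (memLp_tensor (Lp.memLp f) (Lp.memLp g)).toLp _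

theorem coeFn_tensor (f : Lp 𝕜 2 (volume : Measure U)) (g : Lp 𝕜 2 (volume : Measure V)) :
    tensor f g =ᵐ[volume] fun z => f z.fst * g z.snd :=
  MemLp.coeFn_toLp _

theorem norm_tensor (f : Lp 𝕜 2 (volume : Measure U)) (g : Lp 𝕜 2 (volume : Measure V)) :
    ‖tensor f g‖ = ‖f‖ * ‖g‖ := by
  rw [tensor, Lp.norm_toLp, eLpNorm_tensor (Lp.aestronglyMeasurable f)
    (Lp.aestronglyMeasurable g), ENNReal.toReal_mul, Lp.norm_def, Lp.norm_def]

theorem tensor_toLp {f : U → 𝕜} {g : V → 𝕜} (hf : MemLp f 2 volume) (hg : MemLp g 2 volume) :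
    tensor (hf.toLp f) (hg.toLp g) = (memLp_tensor hf hg).toLp _ := by
  refine MemLp.toLp_congr _ _ ?_
  filter_upwards [quasiMeasurePreserving_fst.ae (hf.coeFn_toLp),
    quasiMeasurePreserving_snd.ae (hg.coeFn_toLp)] with z h1 h2
  rw [h1, h2]

variable (U V 𝕜) in
/-- The tensor product as a continuous bilinear map. -/
def tensorCLM : Lp 𝕜 2 (volume : Measure U) →L[𝕜] Lp 𝕜 2 (volume : Measure V) →L[𝕜]
    Lp 𝕜 2 (volume : Measure (WithLp 2 (U × V))) :=
  LinearMap.mkContinuous₂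
    (LinearMap.mk₂ 𝕜 tensor
      (fun f f' g => by
        refine Lp.ext ?_
        filter_upwards [coeFn_tensor (f + f') g, coeFn_tensor f g, coeFn_tensor f' g,
          Lp.coeFn_add (tensor f g) (tensor f' g),
          quasiMeasurePreserving_fst.ae (Lp.coeFn_add f f')] with z h1 h2 h3 h4 h5
        rw [h1, h4, Pi.add_apply, h2, h3, h5, Pi.add_apply, add_mul])
      (fun c f g => by
        refine Lp.ext ?_
        filter_upwards [coeFn_tensor (c • f) g, coeFn_tensor f g,
          Lp.coeFn_smul c (tensor f g),
          quasiMeasurePreserving_fst.ae (Lp.coeFn_smul c f)] with z h1 h2 h3 h4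
        rw [h1, h3, Pi.smul_apply, h2, h4, Pi.smul_apply, smul_mul_assoc])
      (fun f g g' => by
        refine Lp.ext ?_
        filter_upwards [coeFn_tensor f (g + g'), coeFn_tensor f g, coeFn_tensor f g',
          Lp.coeFn_add (tensor f g) (tensor f g'),
          quasiMeasurePreserving_snd.ae (Lp.coeFn_add g g')] with z h1 h2 h3 h4 h5
        rw [h1, h4, Pi.add_apply, h2, h3, h5, Pi.add_apply, mul_add])
      (fun c f g => by
        refine Lp.ext ?_
        filter_upwards [coeFn_tensor f (c • g), coeFn_tensor f g,
          Lp.coeFn_smul c (tensor f g),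
          quasiMeasurePreserving_snd.ae (Lp.coeFn_smul c g)] with z h1 h2 h3 h4
        rw [h1, h3, Pi.smul_apply, h2, h4, Pi.smul_apply, mul_smul_comm]))
    1 (fun f g => by rw [one_mul]; exact (norm_tensor f g).le)

/-- Joint continuity lets the density argument of `fourier_tensor` run in both factors at once. -/
theorem continuous_tensor :
    Continuous fun p : Lp 𝕜 2 (volume : Measure U) × Lp 𝕜 2 (volume : Measure V) =>
      tensor p.1 p.2 :=
  (tensorCLM U V 𝕜).continuous₂

theorem integrable_tensor {f : U → ℂ} {g : V → ℂ} (hf : Integrable f) (hg : Integrable g) :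
    Integrable fun z : WithLp 2 (U × V) => f z.fst * g z.snd :=
  integrable_withLp_prod.2 (hf.mul_prod hg)

/-- The Fourier integral of a tensor product. -/
theorem fourierIntegral_tensor (f : U → ℂ) (g : V → ℂ) (ζ : WithLp 2 (U × V)) :
    𝓕 (fun z : WithLp 2 (U × V) => f z.fst * g z.snd) ζ = 𝓕 f ζ.fst * 𝓕 g ζ.snd := by
  simp only [Real.fourier_eq]
  rw [← integral_prod_mul]
  refine Eq.trans ?_ (integral_withLp_prod
    fun p => (Real.fourierChar (-inner ℝ p.1 ζ.fst) • f p.1) *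
      (Real.fourierChar (-inner ℝ p.2 ζ.snd) • g p.2))
  refine integral_congr_ae (ae_of_all _ fun z => ?_)
  simp only [WithLp.prod_inner_apply, neg_add, AddChar.map_add_eq_mul, Circle.smul_def,
    Circle.coe_mul, smul_eq_mul]
  change _ * (f z.fst * g z.snd) = _ * f z.fst * (_ * g z.snd)
  rw [mul_mul_mul_comm]
  rfl

/-- The `L²` Fourier transform of a tensor product. -/
theorem fourier_tensor (f : Lp ℂ 2 (volume : Measure U)) (g : Lp ℂ 2 (volume : Measure V)) :
    𝓕 (tensor f g) = tensor (𝓕 f) (𝓕 g) := by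
  have hd := (SchwartzMap.denseRange_toLpCLM (F := ℂ) (E := U) (p := 2) (μ := volume)
    (by norm_num)).prodMap (SchwartzMap.denseRange_toLpCLM (F := ℂ) (E := V) (p := 2)
      (μ := volume) (by norm_num))
  -- Both sides are continuous in the pair, so Schwartz factors suffice; for those Fubini applies to
  -- the integrals.
  refine hd.induction_on (p := fun q => 𝓕 (tensor q.1 q.2) = tensor (𝓕 q.1) (𝓕 q.2)) (f, g)
    (isClosed_eq ?_ ?_) ?_
  · exact (Lp.fourierTransformₗᵢ (WithLp 2 (U × V)) ℂ).continuous.comp continuous_tensor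
  · exact continuous_tensor.comp (((Lp.fourierTransformₗᵢ U ℂ).continuous.comp
      continuous_fst).prodMk ((Lp.fourierTransformₗᵢ V ℂ).continuous.comp continuous_snd))
  · rintro ⟨φ, ψ⟩
    change 𝓕 (tensor (φ.toLp 2) (ψ.toLp 2)) = tensor (𝓕 (φ.toLp 2)) (𝓕 (ψ.toLp 2))
    rw [SchwartzMap.toLp_fourier_eq, SchwartzMap.toLp_fourier_eq]
    simp only [SchwartzMap.toLp, tensor_toLp]
    refine Lp.ext ?_
    refine (coeFn_fourier_toLp (integrable_tensor φ.integrable ψ.integrable)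
      (memLp_tensor (φ.memLp 2 volume) (ψ.memLp 2 volume))).trans ?_
    filter_upwards [MemLp.coeFn_toLp
      (memLp_tensor ((𝓕 φ).memLp 2 volume) ((𝓕 ψ).memLp 2 volume))] with ζ hζ
    rw [hζ, fourierIntegral_tensor]
    rfl

end Tensor

/-! ### Partial pairing and Parseval in one variable -/

section Pairing

variable {U V : Type} [NormedAddCommGroup U] [InnerProductSpace ℝ U] [FiniteDimensional ℝ U]
  [MeasurableSpace U] [BorelSpace U]
  [NormedAddCommGroup V] [InnerProductSpace ℝ V] [FiniteDimensional ℝ V]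
  [MeasurableSpace V] [BorelSpace V]

theorem ae_ae_of_ae_withLp_prod {p : WithLp 2 (U × V) → Prop}
    (h : ∀ᵐ z : WithLp 2 (U × V), p z) :
    ∀ᵐ x : U, ∀ᵐ t : V, p (WithLp.toLp 2 (x, t)) :=
  Measure.ae_ae_of_ae_prod
    ((WithLp.volume_preserving_toLp (U := U) (V := V)).quasiMeasurePreserving.ae h)

theorem aestronglyMeasurable_comp_toLp {X : Type} [TopologicalSpace X]
    {w : WithLp 2 (U × V) → X} (hw : AEStronglyMeasurable w volume) :
    AEStronglyMeasurable (fun p : U × V => w (WithLp.toLp 2 p))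
      ((volume : Measure U).prod (volume : Measure V)) :=
  hw.comp_quasiMeasurePreserving
    (WithLp.volume_preserving_toLp (U := U) (V := V)).quasiMeasurePreserving

theorem lintegral_lintegral_withLp {F : WithLp 2 (U × V) → ℝ≥0∞} (hF : AEMeasurable F volume) :
    ∫⁻ x : U, ∫⁻ t : V, F (WithLp.toLp 2 (x, t)) = ∫⁻ z, F z := by
  have h := lintegral_withLp_prod (U := U) (V := V) fun p => F (WithLp.toLp 2 p)
  refine Eq.trans ?_ h.symm
  exact (lintegral_prod _ (hF.comp_quasiMeasurePreserving
    (WithLp.volume_preserving_toLp (U := U) (V := V)).quasiMeasurePreserving)).symm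

theorem enorm_integral_conj_mul_sq_le {f g : V → ℂ} (hf : AEStronglyMeasurable f volume)
    (hg : AEStronglyMeasurable g volume) :
    ‖∫ t, (starRingEnd ℂ) (f t) * g t‖ₑ ^ 2 ≤ (∫⁻ t, ‖f t‖ₑ ^ 2) * ∫⁻ t, ‖g t‖ₑ ^ 2 := by
  have h1 := enorm_integral_le_lintegral_enorm (μ := (volume : Measure V))
    (fun t => (starRingEnd ℂ) (f t) * g t)
  have h2 := ENNReal.lintegral_mul_le_Lp_mul_Lq (volume : Measure V) Real.HolderConjugate.two_two
    hf.enorm hg.enorm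
  simp only [enorm_mul, RCLike.enorm_conj] at h1
  refine (pow_le_pow_left' (h1.trans h2) 2).trans_eq ?_
  rw [mul_pow, ← ENNReal.rpow_natCast, ← ENNReal.rpow_natCast, ← ENNReal.rpow_mul,
    ← ENNReal.rpow_mul]
  norm_num

/-- Cauchy–Schwarz in `t` on almost every fibre. -/
theorem enorm_pairing_sq_le (ψ : Lp ℂ 2 (volume : Measure V))
    (w : Lp ℂ 2 (volume : Measure (WithLp 2 (U × V)))) :
    ∀ᵐ x : U, ‖∫ t, (starRingEnd ℂ) (ψ t) * w (WithLp.toLp 2 (x, t))‖ₑ ^ 2 ≤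
      ‖ψ‖ₑ ^ 2 * ∫⁻ t, ‖w (WithLp.toLp 2 (x, t))‖ₑ ^ 2 := by
  filter_upwards [(aestronglyMeasurable_comp_toLp (Lp.aestronglyMeasurable w)).prodMk_left]
    with x hx
  rw [Lp.enorm_def, eLpNorm_two_sq]
  exact enorm_integral_conj_mul_sq_le (Lp.aestronglyMeasurable ψ) hx

theorem memLp_pairing (ψ : Lp ℂ 2 (volume : Measure V))
    (w : Lp ℂ 2 (volume : Measure (WithLp 2 (U × V)))) :
    MemLp (fun x : U => ∫ t, (starRingEnd ℂ) (ψ t) * w (WithLp.toLp 2 (x, t))) 2 volume := by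
  refine ⟨?_, ?_⟩
  · refine AEStronglyMeasurable.integral_prod_right'
      (f := fun p : U × V => (starRingEnd ℂ) (ψ p.2) * w (WithLp.toLp 2 p)) ?_
    exact (Complex.continuous_conj.comp_aestronglyMeasurable
      ((Lp.aestronglyMeasurable ψ).comp_quasiMeasurePreserving
        Measure.quasiMeasurePreserving_snd)).mul
      (aestronglyMeasurable_comp_toLp (Lp.aestronglyMeasurable w))
  · have h2 : eLpNorm (fun x : U => ∫ t, (starRingEnd ℂ) (ψ t) * w (WithLp.toLp 2 (x, t))) 2
        volume ^ 2 < ⊤ := by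
      rw [eLpNorm_two_sq]
      refine (lintegral_mono_ae (enorm_pairing_sq_le ψ w)).trans_lt ?_
      rw [lintegral_const_mul' _ _ (by simp),
        lintegral_lintegral_withLp (F := fun z => ‖w z‖ₑ ^ 2)
          ((Lp.aestronglyMeasurable w).enorm.pow_const 2), ← eLpNorm_two_sq, ← Lp.enorm_def]
      exact ENNReal.mul_lt_top (by simp) (by simp)
    simpa using h2

/-- The partial pairing `x ↦ ∫ conj (ψ(t)) w(x, t) dt`. -/
def pairing (ψ : Lp ℂ 2 (volume : Measure V))
    (w : Lp ℂ 2 (volume : Measure (WithLp 2 (U × V)))) : Lp ℂ 2 (volume : Measure U) :=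
  (memLp_pairing ψ w).toLp _

/-- By Fubini, pairing with `ψ` is the adjoint of `f ↦ f ⊗ ψ`, so facts about tensor products pass
to pairings by duality. -/
theorem inner_pairing (f : Lp ℂ 2 (volume : Measure U)) (ψ : Lp ℂ 2 (volume : Measure V))
    (w : Lp ℂ 2 (volume : Measure (WithLp 2 (U × V)))) :
    inner ℂ f (pairing ψ w) = inner ℂ (tensor f ψ) w := by
  have hint := L2.integrable_inner (𝕜 := ℂ) (tensor f ψ) w
  have hae : (fun z => inner ℂ (tensor f ψ z) (w z)) =ᵐ[volume]
      fun z : WithLp 2 (U × V) => inner ℂ (f z.fst * ψ z.snd) (w z) := by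
    filter_upwards [coeFn_tensor f ψ] with z hz
    rw [hz]
  rw [L2.inner_def, L2.inner_def, integral_congr_ae hae]
  have hint' : Integrable fun p : U × V => inner ℂ (f p.1 * ψ p.2) (w (WithLp.toLp 2 p)) :=
    integrable_withLp_prod.1 (hint.congr hae)
  refine Eq.trans ?_ (integral_withLp_prod fun p : U × V =>
    inner ℂ (f p.1 * ψ p.2) (w (WithLp.toLp 2 p))).symm
  refine Eq.trans ?_ (integral_prod _ hint').symm
  refine integral_congr_ae ?_
  filter_upwards [(memLp_pairing ψ w).coeFn_toLp] with x hx
  rw [pairing, hx]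
  simp only [RCLike.inner_apply, map_mul]
  rw [← integral_mul_const]
  refine integral_congr_ae (ae_of_all _ fun t => ?_)
  change _ = _ * _
  ring

/-- Parseval's identity in the second variable. -/
theorem fourier_pairing (ψ : Lp ℂ 2 (volume : Measure V))
    (w : Lp ℂ 2 (volume : Measure (WithLp 2 (U × V)))) :
    𝓕 (pairing ψ w) = pairing (𝓕 ψ) (𝓕 w) := by
  -- The Fourier transform is onto and unitary, so it is enough to test against transforms `𝓕 f`.
  refine ext_inner_left ℂ fun f => ?_
  obtain ⟨f, rfl⟩ := (Lp.fourierTransformₗᵢ U ℂ).surjective f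
  change inner ℂ (𝓕 f) _ = inner ℂ (𝓕 f) _
  rw [Lp.inner_fourier_eq, inner_pairing, inner_pairing, ← fourier_tensor, Lp.inner_fourier_eq]

end Pairing

/-! ### Real functions as complex ones -/

section Complexify

variable {V : Type} [NormedAddCommGroup V] [InnerProductSpace ℝ V] [FiniteDimensional ℝ V]
  [MeasurableSpace V] [BorelSpace V]

/-- A real-valued `L²` function regarded as complex-valued. -/
def complexify (u : L2 V) : Lp ℂ 2 (volume : Measure V) := Complex.ofRealCLM.compLp u

theorem coeFn_complexify (u : L2 V) : complexify u =ᵐ[volume] fun z => (u z : ℂ) :=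
  Complex.ofRealCLM.coeFn_compLp u

theorem fourierL2_eq (u : L2 V) : fourierL2 u = 𝓕 (complexify u) := rfl

theorem norm_complexify (u : L2 V) : ‖complexify u‖ = ‖u‖ := by
  rw [Lp.norm_def, Lp.norm_def]
  congr 1
  refine eLpNorm_congr_norm_ae ?_
  filter_upwards [coeFn_complexify u] with z hz
  rw [hz, Complex.norm_real]

theorem norm_fourierL2 (u : L2 V) : ‖fourierL2 u‖ = ‖u‖ := by
  rw [fourierL2_eq, Lp.norm_fourier_eq, norm_complexify]

end Complexify

/-! ### Averaging decreases the energy -/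

section Average

variable {n k : ℕ}

theorem complexify_average {B : Set (E k)} (hB : MeasurableSet B) (hBt : volume B ≠ ⊤)
    (v : L2 (EE n k)) :
    complexify (averageL2 B v) =
      pairing (indicatorConstLp 2 hB hBt ((volume.real B)⁻¹ : ℂ)) (complexify v) := by
  refine Lp.ext ?_
  filter_upwards [coeFn_complexify (averageL2 B v), (memLp_average B v).coeFn_toLp,
    (memLp_pairing (indicatorConstLp 2 hB hBt ((volume.real B)⁻¹ : ℂ)) (complexify v)).coeFn_toLp,
    ae_ae_of_ae_withLp_prod (coeFn_complexify v)] with x h1 h2 h3 h4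
  rw [h1, averageL2, h2, pairing, h3, setAverage_eq, smul_eq_mul, Complex.ofReal_mul,
    ← integral_complex_ofReal, ← integral_const_mul, ← integral_indicator hB]
  refine integral_congr_ae ?_
  filter_upwards [h4, indicatorConstLp_coeFn (p := 2) (hs := hB) (hμs := hBt)
    (c := ((volume.real B)⁻¹ : ℂ))] with t h5 h6
  rw [h5, h6]
  by_cases ht : t ∈ B <;> simp [ht]

/-- Averaging over `B` decreases the energy per unit volume of `B`. -/
theorem energy_average_le {s : ℝ} (hs : 0 ≤ s) {B : Set (E k)} (hB : MeasurableSet B)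
    (hB0 : volume B ≠ 0) (hBt : volume B ≠ ⊤) (v : L2 (EE n k)) :
    energy s (averageL2 B v) ≤ (volume B)⁻¹ * energy s v := by
  set ψ : Lp ℂ 2 (volume : Measure (E k)) :=
    indicatorConstLp 2 hB hBt ((volume.real B)⁻¹ : ℂ) with hψ
  -- Plancherel: the mass of `ψ` is `|B|⁻² |B|`.
  have hψn : ‖𝓕 ψ‖ₑ ^ 2 = (volume B)⁻¹ := by
    rw [← ofReal_norm, Lp.norm_fourier_eq, ofReal_norm, Lp.enorm_def, eLpNorm_two_sq]
    have h : ∀ᵐ t, ‖ψ t‖ₑ ^ 2 = B.indicator (fun _ => (volume B)⁻¹ ^ 2) t := by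
      filter_upwards [indicatorConstLp_coeFn (p := 2) (hs := hB) (hμs := hBt)
        (c := ((volume.real B)⁻¹ : ℂ))] with t ht
      rw [hψ, ht]
      by_cases htB : t ∈ B
      · simp only [htB, Set.indicator_of_mem]
        rw [enorm_inv (by simp [measureReal_def, ENNReal.toReal_eq_zero_iff, hB0, hBt]),
          ← ofReal_norm, Complex.norm_real, Real.norm_of_nonneg measureReal_nonneg,
          ofReal_measureReal hBt]
      · simp [htB]
    rw [lintegral_congr_ae h, lintegral_indicator_const hB, sq, mul_assoc,
      ENNReal.inv_mul_cancel hB0 hBt, mul_one]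
  have hF : fourierL2 (averageL2 B v) = pairing (𝓕 ψ) (fourierL2 v) := by
    rw [fourierL2_eq, complexify_average hB hBt, fourier_pairing, fourierL2_eq]
  have hm : ∀ z : EE n k, ‖z.fst‖ ≤ ‖z‖ := fun z => by
    have := WithLp.prod_norm_sq_eq_of_L2 z
    nlinarith [norm_nonneg z, norm_nonneg z.fst, sq_nonneg ‖z.snd‖]
  have hmeas : AEMeasurable (fun z : EE n k =>
      ENNReal.ofReal ((2 * π * ‖z.fst‖) ^ (2 * s)) * ‖fourierL2 v z‖ₑ ^ 2) volume := by
    refine AEMeasurable.mul ?_ ((Lp.aestronglyMeasurable _).enorm.pow_const 2)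
    have h : Measurable fun x : E n => ENNReal.ofReal ((2 * π * ‖x‖) ^ (2 * s)) := by fun_prop
    exact h.aemeasurable.comp_quasiMeasurePreserving quasiMeasurePreserving_fst
  calc energy s (averageL2 B v)
      ≤ ∫⁻ ξ : E n, (volume B)⁻¹ * ∫⁻ τ : E k, ENNReal.ofReal ((2 * π * ‖ξ‖) ^ (2 * s)) *
          ‖fourierL2 v (WithLp.toLp 2 (ξ, τ))‖ₑ ^ 2 := by
        rw [energy, hF]
        refine lintegral_mono_ae ?_
        filter_upwards [enorm_pairing_sq_le (𝓕 ψ) (fourierL2 v),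
          (memLp_pairing (𝓕 ψ) (fourierL2 v)).coeFn_toLp] with ξ h1 h2
        rw [pairing, h2, lintegral_const_mul' _ _ ENNReal.ofReal_ne_top, mul_left_comm, ← hψn]
        gcongr
    _ = (volume B)⁻¹ * ∫⁻ z : EE n k, ENNReal.ofReal ((2 * π * ‖z.fst‖) ^ (2 * s)) *
          ‖fourierL2 v z‖ₑ ^ 2 := by
        rw [lintegral_const_mul' _ _ (ENNReal.inv_ne_top.2 hB0), ← lintegral_lintegral_withLp hmeas]
        rfl
    _ ≤ (volume B)⁻¹ * energy s v := by
        rw [energy]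
        gcongr with z
        exact hm z

/-- The closure of the cylinder projects into `closure ω`, so `v` vanishes on almost every fibre
over the complement. -/
theorem average_eq_zero {B : Set (E k)} {ω : Set (E n)} {v : L2 (EE n k)}
    (hv : ∀ᵐ z, z ∉ closure (cyl ω B) → v z = 0) :
    ∀ᵐ x, x ∉ closure ω → averageL2 B v x = 0 := by
  filter_upwards [(memLp_average B v).coeFn_toLp, ae_ae_of_ae_withLp_prod hv] with x h1 h2 hx
  have h3 : ∀ᵐ t : E k, v (WithLp.toLp 2 (x, t)) = 0 := by
    filter_upwards [h2] with t ht
    refine ht fun hmem => hx ?_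
    exact map_mem_closure (WithLp.prod_continuous_ofLp 2 (E n) (E k)).fst hmem
      fun z hz => hz.1
  rw [averageL2, h1, setAverage_eq, integral_eq_zero_of_ae (ae_restrict_of_ae h3), smul_zero]

theorem average_mem_tildeHSub {s : ℝ} (hs : 0 ≤ s) {B : Set (E k)} (hB : MeasurableSet B)
    (hB0 : volume B ≠ 0) (hBt : volume B ≠ ⊤) {ω : Set (E n)} (v : TildeH s (cyl ω B)) :
    averageL2 B v.toL2 ∈ tildeHSub s ω :=
  ⟨(energy_average_le hs hB hB0 hBt _).trans_lt
    (ENNReal.mul_lt_top (ENNReal.inv_lt_top.2 hB0.bot_lt) v.2.1), average_eq_zero v.2.2⟩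

/-- The Jacobian of `t ↦ t / ℓ` cancels against the volume of `ℓB`. -/
theorem average_dilate {ℓ : ℝ} (hℓ : 0 < ℓ) (B : Set (E k)) (v : L2 (EE n k)) :
    averageL2 (ℓ • B) (dilate hℓ v) = averageL2 B v := by
  refine MemLp.toLp_congr _ _ ?_
  filter_upwards [ae_ae_of_ae_withLp_prod (memLp_dilate hℓ v).coeFn_toLp] with x hx
  rw [setAverage_eq, setAverage_eq, dilate, integral_congr_ae (ae_restrict_of_ae hx)]
  have h := Measure.setIntegral_comp_smul (volume : Measure (E k))
    (fun t => v (WithLp.toLp 2 (x, t))) (ℓ • B) (inv_ne_zero hℓ.ne')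
  rw [inv_smul_smul₀ hℓ.ne'] at h
  refine (congrArg _ h).trans ?_
  rw [measureReal_def, Measure.addHaar_smul, ENNReal.toReal_mul,
    ENNReal.toReal_ofReal (abs_nonneg _), ← measureReal_def, smul_smul]
  congr 1
  have : |ℓ ^ Module.finrank ℝ (E k)| ≠ 0 := abs_ne_zero.2 (pow_ne_zero _ hℓ.ne')
  rw [inv_pow, inv_inv, mul_inv, mul_comm (_⁻¹), mul_assoc, inv_mul_cancel₀ this, mul_one]

/-- This is `energy_average_le` for the set `ℓB` and the dilated function, whose average does not
depend on `ℓ`. -/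
theorem energy_average_le_rescaledEnergy {s : ℝ} (hs : 0 ≤ s) {B : Set (E k)}
    (hB : MeasurableSet B) (hB0 : volume B ≠ 0) (hBt : volume B ≠ ⊤) {ℓ : ℝ} (hℓ : 0 < ℓ)
    (v : L2 (EE n k)) :
    energy s (averageL2 B v) ≤ rescaledEnergy s B hℓ v := by
  have hℓ' : ENNReal.ofReal |ℓ ^ Module.finrank ℝ (E k)| ≠ 0 := by
    rw [Ne, ENNReal.ofReal_eq_zero, not_le]
    positivity
  rw [← average_dilate hℓ B v, rescaledEnergy]
  refine energy_average_le hs (hB.const_smul₀ ℓ) ?_ ?_ _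
  · rw [Measure.addHaar_smul]
    exact mul_ne_zero hℓ' hB0
  · rw [Measure.addHaar_smul]
    exact ENNReal.mul_ne_top ENNReal.ofReal_ne_top hBt

end Average

theorem tendsto_nhds_weakAveraged_iff {X Y ι : Type} [NormedAddCommGroup Y] [NormedSpace ℝ Y]
    {ρ : X → Y} {l : Filter ι} {w : ι → X} {v : X} :
    Tendsto w l (@nhds X (weakAveraged ρ) v) ↔
      ∀ T : StrongDual ℝ Y, Tendsto (fun i => T (ρ (w i))) l (𝓝 (T (ρ v))) := by
  simp only [nhds_iInf, tendsto_iInf, nhds_induced, tendsto_comap_iff]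
  rfl

/-! ### Lower semicontinuity, scaling and finiteness of the energy -/

section Energy

variable {V : Type} [NormedAddCommGroup V] [InnerProductSpace ℝ V] [FiniteDimensional ℝ V]
  [MeasurableSpace V] [BorelSpace V] {s : ℝ} {U : Set V}

theorem energy_eq_lintegral_halfSymbol (u : L2 V) :
    energy s u = ∫⁻ η, ‖halfSymbol s u η‖ₑ ^ 2 := by
  rw [← eLpNorm_halfSymbol_sq, eLpNorm_two_sq]

theorem norm_indicator_halfSymbol_le (hs : 0 ≤ s) (r : ℕ) (u : L2 V) (η : V) :
    ‖(Metric.closedBall 0 (r : ℝ)).indicator (halfSymbol s u) η‖ ≤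
      (2 * π * r) ^ s * ‖(fourierL2 u : V → ℂ) η‖ := by
  by_cases hη : η ∈ Metric.closedBall 0 (r : ℝ)
  · have h0 : 0 ≤ 2 * π * ‖η‖ := by positivity
    rw [Set.indicator_of_mem hη, halfSymbol, norm_smul, Real.norm_of_nonneg (by positivity)]
    refine mul_le_mul_of_nonneg_right (Real.rpow_le_rpow h0 ?_ hs) (norm_nonneg _)
    have := mem_closedBall_zero_iff.1 hη
    gcongr
  · rw [Set.indicator_of_notMem hη, norm_zero]
    positivity

theorem memLp_indicator_halfSymbol (hs : 0 ≤ s) (r : ℕ) (u : L2 V) :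
    MemLp ((Metric.closedBall 0 (r : ℝ)).indicator (halfSymbol s u)) 2 (volume : Measure V) :=
  (Lp.memLp (fourierL2 u)).of_le_mul
    ((aestronglyMeasurable_halfSymbol s u).indicator Metric.isClosed_closedBall.measurableSet)
    (ae_of_all _ (norm_indicator_halfSymbol_le hs r u))

/-- The truncated Fourier multiplier `u ↦ 1_{|ξ| ≤ 2πr} |ξ|ˢ 𝓕[u]`, bounded on `L²`. -/
def truncatedMultiplier (hs : 0 ≤ s) (r : ℕ) : L2 V →L[ℝ] Lp ℂ 2 (volume : Measure V) :=
  LinearMap.mkContinuous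
    { toFun := fun u => (memLp_indicator_halfSymbol hs r u).toLp _
      map_add' := fun u v => by
        rw [← MemLp.toLp_add]
        refine MemLp.toLp_congr _ _ ?_
        filter_upwards [halfSymbol_add s u v] with η hη
        by_cases h : η ∈ Metric.closedBall 0 (r : ℝ)
        · simpa only [Pi.add_apply, Set.indicator_of_mem h] using hη
        · simp only [Pi.add_apply, Set.indicator_of_notMem h, add_zero]
      map_smul' := fun c u => by
        rw [RingHom.id_apply, ← MemLp.toLp_const_smul]
        refine MemLp.toLp_congr _ _ ?_
        filter_upwards [halfSymbol_smul s c u] with η hη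
        by_cases h : η ∈ Metric.closedBall 0 (r : ℝ)
        · simpa only [Pi.smul_apply, Set.indicator_of_mem h] using hη
        · simp only [Pi.smul_apply, Set.indicator_of_notMem h, smul_zero] }
    ((2 * π * r) ^ s) fun u => by
      rw [← norm_fourierL2 u]
      refine Lp.norm_le_mul_norm_of_ae_le_mul ?_
      filter_upwards [(memLp_indicator_halfSymbol hs r u).coeFn_toLp] with η hη
      exact (congrArg norm hη).trans_le (norm_indicator_halfSymbol_le hs r u η)

theorem ofReal_norm_truncatedMultiplier_sq (hs : 0 ≤ s) (r : ℕ) (u : L2 V) :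
    ENNReal.ofReal (‖truncatedMultiplier hs r u‖ ^ 2) =
      ∫⁻ η in Metric.closedBall 0 (r : ℝ), ‖halfSymbol s u η‖ₑ ^ 2 := by
  have h : ‖truncatedMultiplier hs r u‖ₑ =
      eLpNorm ((Metric.closedBall 0 (r : ℝ)).indicator (halfSymbol s u)) 2 volume :=
    Lp.enorm_toLp (memLp_indicator_halfSymbol hs r u)
  rw [ENNReal.ofReal_pow (norm_nonneg _), ofReal_norm, h,
    eLpNorm_indicator_eq_eLpNorm_restrict Metric.isClosed_closedBall.measurableSet,
    eLpNorm_two_sq]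

/-- The balls exhaust frequency space, so the energy is a limit of continuous quadratic forms on
`L²` lying below it. -/
theorem tendsto_norm_truncatedMultiplier_sq (hs : 0 ≤ s) (u : L2 V) :
    Tendsto (fun r : ℕ => ENNReal.ofReal (‖truncatedMultiplier hs r u‖ ^ 2)) atTop
      (𝓝 (energy s u)) := by
  simp only [ofReal_norm_truncatedMultiplier_sq, energy_eq_lintegral_halfSymbol]
  exact (aecover_closedBall tendsto_natCast_atTop_atTop).lintegral_tendsto_of_countably_generated
    ((aestronglyMeasurable_halfSymbol s u).enorm.pow_const 2)

theorem ofReal_norm_truncatedMultiplier_sq_le (hs : 0 ≤ s) (r : ℕ) (u : L2 V) :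
    ENNReal.ofReal (‖truncatedMultiplier hs r u‖ ^ 2) ≤ energy s u := by
  rw [ofReal_norm_truncatedMultiplier_sq, energy_eq_lintegral_halfSymbol]
  exact setLIntegral_le_lintegral _ _

/-- The energy is sequentially lower semicontinuous for the weak topology of `L²`. -/
theorem energy_le_liminf (hs : 0 ≤ s) {u : L2 V} {w : ℕ → L2 V}
    (h : ∀ T : StrongDual ℝ (L2 V), Tendsto (fun i => T (w i)) atTop (𝓝 (T u))) :
    ((energy s u : ℝ≥0∞) : EReal) ≤ liminf (fun i => ((energy s (w i) : ℝ≥0∞) : EReal)) atTop := by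
  refine le_of_tendsto ((continuous_coe_ennreal_ereal.tendsto _).comp
    (tendsto_norm_truncatedMultiplier_sq hs u)) (Eventually.of_forall fun r => ?_)
  set A : L2 V →L[ℝ] Lp ℂ 2 (volume : Measure V) := truncatedMultiplier hs r with hA
  -- The minorant `2⟨Au, Aw⟩ - ‖Au‖²` of `‖Aw‖²` is affine, hence weakly continuous, in `w`, with
  -- equality at `w = u`. That it is a minorant is `‖Au - Aw‖² ≥ 0`.
  have hlim : Tendsto (fun i => 2 * inner ℝ (A u) (A (w i)) - ‖A u‖ ^ 2) atTop
      (𝓝 (‖A u‖ ^ 2)) := by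
    have h2 := ((h ((innerSL ℝ (A u)).comp A)).const_mul 2).sub_const (‖A u‖ ^ 2)
    have h3 : 2 * ((innerSL ℝ (A u)).comp A) u - ‖A u‖ ^ 2 = ‖A u‖ ^ 2 := by
      change 2 * inner ℝ (A u) (A u) - ‖A u‖ ^ 2 = _
      rw [real_inner_self_eq_norm_sq]
      ring
    rw [h3] at h2
    exact h2
  have hE := ((continuous_coe_real_ereal.tendsto _).comp hlim).liminf_eq
  rw [Function.comp_apply, EReal.coe_ennreal_ofReal, max_eq_left (sq_nonneg _), ← hE]
  refine liminf_le_liminf (Eventually.of_forall fun i => ?_)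
  refine le_trans ?_ (EReal.coe_ennreal_le_coe_ennreal_iff.2
    (ofReal_norm_truncatedMultiplier_sq_le hs r (w i)))
  rw [EReal.coe_ennreal_ofReal, max_eq_left (sq_nonneg _)]
  refine EReal.coe_le_coe_iff.2 ?_
  have h4 := norm_sub_sq_real (A u) (A (w i))
  nlinarith [sq_nonneg ‖A u - A (w i)‖]

theorem TildeH.norm_toL2_le (u : TildeH s U) : ‖TildeH.toL2 u‖ ≤ ‖u‖ := by
  refine le_of_sq_le_sq ?_ (norm_nonneg u)
  rw [TildeH.norm_sq]
  exact le_add_of_nonneg_left ENNReal.toReal_nonneg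

/-- An element of `tildeHSub s U` as an element of `H̃ˢ(U)`, with the norm of `Hˢ`. -/
def TildeH.ofMem {u : L2 V} (hu : u ∈ tildeHSub s U) : TildeH s U := ⟨u, hu⟩

variable (s U) in
/-- The identity from `H̃ˢ(U)` with its own norm to the same space with the norm of `L²`. -/
def TildeH.toSubmodule : TildeH s U →L[ℝ] tildeHSub s U :=
  LinearMap.mkContinuous
    { toFun := fun u => ⟨TildeH.toL2 u, u.2⟩
      map_add' := fun _ _ => rfl
      map_smul' := fun _ _ => rfl } 1 fun u => by
    rw [one_mul]
    exact TildeH.norm_toL2_le u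

theorem memLp_complex_ofReal {φ : V → ℝ} (hφ : MemLp φ 2 volume) :
    MemLp (fun t => (φ t : ℂ)) 2 volume :=
  hφ.ofReal

theorem complexify_toLp {φ : V → ℝ} (hφ : MemLp φ 2 volume) :
    complexify (hφ.toLp φ) = (memLp_complex_ofReal hφ).toLp _ := by
  refine Lp.ext ?_
  filter_upwards [coeFn_complexify (hφ.toLp φ), hφ.coeFn_toLp,
    (memLp_complex_ofReal hφ).coeFn_toLp] with t h1 h2 h3
  rw [h1, h2, h3]

theorem energy_toLp {φ : V → ℝ} (hφ1 : Integrable φ) (hφ : MemLp φ 2 volume) :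
    energy s (hφ.toLp φ) = ∫⁻ η : V, ENNReal.ofReal ((2 * π * ‖η‖) ^ (2 * s)) *
      ‖𝓕 (fun t => (φ t : ℂ)) η‖ₑ ^ 2 := by
  rw [energy, fourierL2_eq, complexify_toLp]
  refine lintegral_congr_ae ?_
  filter_upwards [coeFn_fourier_toLp (f := fun t => (φ t : ℂ)) hφ1.ofReal
    (memLp_complex_ofReal hφ)] with η h
  rw [h]

theorem lintegral_comp_smul (f : V → ℝ≥0∞) {r : ℝ} (hr : r ≠ 0) :
    ∫⁻ x : V, f (r • x) = ENNReal.ofReal |(r ^ Module.finrank ℝ V)⁻¹| * ∫⁻ x, f x := by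
  rw [← smul_eq_mul, ← lintegral_smul_measure, ← Measure.map_addHaar_smul _ hr]
  exact ((Homeomorph.smulOfNeZero r hr).measurableEmbedding.lintegral_map _).symm

theorem fourierIntegral_comp_inv_smul (f : V → ℂ) {r : ℝ} (hr : 0 < r) (τ : V) :
    𝓕 (fun t => f (r⁻¹ • t)) τ = (r ^ Module.finrank ℝ V : ℝ) • 𝓕 f (r • τ) := by
  have h := Measure.integral_comp_smul (volume : Measure V)
    (fun t => Real.fourierChar (-inner ℝ t (r • τ)) • f t) r⁻¹
  rw [inv_pow, inv_inv, abs_of_pos (pow_pos hr _)] at h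
  rw [Real.fourier_eq, Real.fourier_eq, ← h]
  refine integral_congr_ae (ae_of_all _ fun t => ?_)
  simp only [inner_smul_left, inner_smul_right, RCLike.conj_to_real]
  rw [← mul_assoc, mul_inv_cancel₀ hr.ne', one_mul]

/-- The energy of a dilated function. -/
theorem energy_comp_inv_smul {φ : V → ℝ} (hφ1 : Integrable φ) (hφ : MemLp φ 2 volume)
    {r : ℝ} (hr : 0 < r) (hφr : MemLp (fun t => φ (r⁻¹ • t)) 2 volume) :
    energy s (hφr.toLp _) =
      ENNReal.ofReal (r ^ Module.finrank ℝ V) * ENNReal.ofReal (r ^ (-(2 * s))) *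
        energy s (hφ.toLp φ) := by
  rw [energy_toLp (hφ1.comp_smul (inv_ne_zero hr.ne')), energy_toLp hφ1]
  set d := Module.finrank ℝ V
  have hd : 0 < r ^ d := pow_pos hr d
  -- The squared modulus of the transform yields `r^(2d)` and homogeneity of the symbol yields
  -- `r^(-2s)`; the change of variables `τ ↦ r • τ` then takes back one factor `r^d`.
  have h : ∀ τ : V, ENNReal.ofReal ((2 * π * ‖τ‖) ^ (2 * s)) *
      ‖𝓕 (fun t => (φ (r⁻¹ • t) : ℂ)) τ‖ₑ ^ 2 =
      ENNReal.ofReal (r ^ d) ^ 2 * ENNReal.ofReal (r ^ (-(2 * s))) *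
        (ENNReal.ofReal ((2 * π * ‖r • τ‖) ^ (2 * s)) * ‖𝓕 (fun t => (φ t : ℂ)) (r • τ)‖ₑ ^ 2) := by
    intro τ
    rw [fourierIntegral_comp_inv_smul (fun t => (φ t : ℂ)) hr, enorm_smul, mul_pow,
      Real.enorm_eq_ofReal hd.le, norm_smul, Real.norm_of_nonneg hr.le]
    have h1 : (2 * π * ‖τ‖) ^ (2 * s) =
        r ^ (-(2 * s)) * (2 * π * (r * ‖τ‖)) ^ (2 * s) := by
      rw [show 2 * π * (r * ‖τ‖) = r * (2 * π * ‖τ‖) by ring,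
        Real.mul_rpow hr.le (by positivity), ← mul_assoc, ← Real.rpow_add hr, neg_add_cancel,
        Real.rpow_zero, one_mul]
    rw [h1, ENNReal.ofReal_mul (by positivity)]
    ring
  simp only [h]
  rw [lintegral_const_mul' _ _ (ENNReal.mul_ne_top (by simp) (by simp)),
    lintegral_comp_smul (fun τ => ENNReal.ofReal ((2 * π * ‖τ‖) ^ (2 * s)) *
      ‖𝓕 (fun t => (φ t : ℂ)) τ‖ₑ ^ 2) hr.ne', ← mul_assoc]
  congr 1
  rw [abs_of_pos (inv_pos.2 hd), ENNReal.ofReal_inv_of_pos hd, sq, mul_right_comm _ _ (_⁻¹),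
    mul_assoc (ENNReal.ofReal (r ^ d)),
    ENNReal.mul_inv_cancel (ENNReal.ofReal_pos.2 hd).ne' ENNReal.ofReal_ne_top, mul_one]

/-- Smooth compactly supported functions have finite energy. -/
theorem energy_toLp_lt_top (hs0 : 0 ≤ s) (hs1 : s ≤ 1) {φ : V → ℝ} (hφc : HasCompactSupport φ)
    (hφs : ContDiff ℝ (⊤ : ℕ∞) φ) (hφ : MemLp φ 2 volume) :
    energy s (hφ.toLp φ) < ⊤ := by
  have hc : HasCompactSupport (fun x => (φ x : ℂ)) := hφc.comp_left Complex.ofReal_zero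
  set G : SchwartzMap V ℂ := hc.toSchwartzMap (Complex.ofRealCLM.contDiff.comp hφs) with hG
  have hGφ : fourierL2 (hφ.toLp φ) = (𝓕 G).toLp 2 := by
    rw [← SchwartzMap.toLp_fourier_eq, fourierL2_eq, complexify_toLp]
    rfl
  have ht : (fun η : V => 1 + ‖η‖ ^ 2).HasTemperateGrowth :=
    (Function.HasTemperateGrowth.const 1).add (Function.hasTemperateGrowth_norm_sq V)
  have hH := ((SchwartzMap.smulLeftCLM ℂ (fun η : V => 1 + ‖η‖ ^ 2)) (𝓕 G)).memLp 2 volume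
  refine (memLp_halfSymbol_iff s _).1 ?_
  -- The constant comes from `(2π|η|)^s ≤ 1 + 2π|η| ≤ 1 + π(1 + |η|²) ≤ (1 + π)(1 + |η|²)`.
  refine hH.of_le_mul (c := 1 + π) (aestronglyMeasurable_halfSymbol s _) ?_
  filter_upwards [SchwartzMap.coeFn_toLp (𝓕 G) 2] with η hη
  rw [SchwartzMap.smulLeftCLM_apply_apply ht, halfSymbol, hGφ, hη, norm_smul, norm_smul,
    ← mul_assoc]
  refine mul_le_mul_of_nonneg_right ?_ (norm_nonneg _)
  have h0 : 0 ≤ 2 * π * ‖η‖ := by positivity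
  rw [Real.norm_of_nonneg (Real.rpow_nonneg h0 s), Real.norm_of_nonneg (by positivity)]
  have h1 : (2 * π * ‖η‖) ^ s ≤ 1 + 2 * π * ‖η‖ := by
    calc (2 * π * ‖η‖) ^ s ≤ (1 + 2 * π * ‖η‖) ^ s := Real.rpow_le_rpow h0 (by linarith) hs0
      _ ≤ (1 + 2 * π * ‖η‖) ^ (1 : ℝ) := Real.rpow_le_rpow_of_exponent_le (by linarith) hs1
      _ = _ := Real.rpow_one _
  nlinarith [Real.pi_pos, mul_nonneg Real.pi_pos.le (sq_nonneg (‖η‖ - 1)), sq_nonneg ‖η‖]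

end Energy

/-! ### Energy of tensor products -/

section EnergyTensor

variable {n k : ℕ} {s : ℝ}

theorem complexify_tensor (u : L2 (E n)) (g : L2 (E k)) :
    complexify (tensor u g) = tensor (complexify u) (complexify g) := by
  refine Lp.ext ?_
  filter_upwards [coeFn_complexify (tensor u g), coeFn_tensor u g,
    coeFn_tensor (complexify u) (complexify g),
    quasiMeasurePreserving_fst.ae (coeFn_complexify u),
    quasiMeasurePreserving_snd.ae (coeFn_complexify g)] with z h1 h2 h3 h4 h5
  rw [h1, h2, h3, h4, h5, Complex.ofReal_mul]

theorem lintegral_enorm_fourierL2_sq (u : L2 (E n)) :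
    ∫⁻ ξ, ‖fourierL2 u ξ‖ₑ ^ 2 = ‖u‖ₑ ^ 2 := by
  rw [← eLpNorm_two_sq, ← Lp.enorm_def, ← ofReal_norm, norm_fourierL2, ofReal_norm]

/-- Since `|z|² = |x|² + |t|²`, this is subadditivity of `r ↦ r^s` on `[0, ∞)`. -/
theorem symbol_le (hs0 : 0 ≤ s) (hs1 : s ≤ 1) (z : EE n k) :
    ENNReal.ofReal ((2 * π * ‖z‖) ^ (2 * s)) ≤
      ENNReal.ofReal ((2 * π * ‖z.fst‖) ^ (2 * s)) +
        ENNReal.ofReal ((2 * π * ‖z.snd‖) ^ (2 * s)) := by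
  have h (r : ℝ) (hr : 0 ≤ r) : (2 * π * r) ^ (2 * s) = ((2 * π) ^ 2 * r ^ 2) ^ s := by
    rw [Real.rpow_mul (by positivity), Real.rpow_two, mul_pow]
  rw [h _ (norm_nonneg _), h _ (norm_nonneg _), h _ (norm_nonneg _),
    WithLp.prod_norm_sq_eq_of_L2, mul_add, ← ENNReal.ofReal_rpow_of_nonneg (by positivity) hs0,
    ← ENNReal.ofReal_rpow_of_nonneg (by positivity) hs0,
    ← ENNReal.ofReal_rpow_of_nonneg (by positivity) hs0,
    ENNReal.ofReal_add (by positivity) (by positivity)]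
  exact ENNReal.rpow_add_le_add_rpow _ _ hs0 hs1

/-- The transform factorises and the symbol splits into a part in each variable; Plancherel turns
the factor without symbol into an `L²` norm. -/
theorem energy_tensor_le (hs0 : 0 ≤ s) (hs1 : s ≤ 1) (u : L2 (E n)) (g : L2 (E k)) :
    energy s (tensor u g) ≤ energy s u * ‖g‖ₑ ^ 2 + ‖u‖ₑ ^ 2 * energy s g := by
  have hm (d : ℕ) : Measurable fun x : E d => ENNReal.ofReal ((2 * π * ‖x‖) ^ (2 * s)) := by
    fun_prop
  have hn (d : ℕ) (w : L2 (E d)) : AEMeasurable (fun x => ‖fourierL2 w x‖ₑ ^ 2) volume :=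
    (Lp.aestronglyMeasurable (fourierL2 w)).enorm.pow_const 2
  have hF : fourierL2 (tensor u g) = tensor (fourierL2 u) (fourierL2 g) := by
    rw [fourierL2_eq, complexify_tensor, fourier_tensor, fourierL2_eq, fourierL2_eq]
  have h1 := lintegral_withLp_mul ((hm n).aemeasurable.mul (hn n u)) (hn k g)
  have h2 := lintegral_withLp_mul (hn n u) ((hm k).aemeasurable.mul (hn k g))
  rw [lintegral_enorm_fourierL2_sq] at h1 h2
  simp only [Pi.mul_apply] at h1 h2
  rw [energy, energy, energy, ← h1, ← h2, ← lintegral_add_left']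
  · refine lintegral_mono_ae ?_
    filter_upwards [coeFn_tensor (fourierL2 u) (fourierL2 g)] with z hz
    rw [hF, hz, enorm_mul, mul_pow]
    refine (mul_le_mul_left (symbol_le hs0 hs1 z) _).trans_eq ?_
    ring
  · exact (((hm n).aemeasurable.mul (hn n u)).comp_quasiMeasurePreserving
      quasiMeasurePreserving_fst).mul
      ((hn k g).comp_quasiMeasurePreserving quasiMeasurePreserving_snd)

end EnergyTensor

/-! ### Cutoffs and the recovery functions -/

section Recovery

/-- Smooth cutoff functions supported in a bounded open set `B` and converging to its indicator. -/
theorem exists_cutoff {V : Type} [NormedAddCommGroup V] [InnerProductSpace ℝ V]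
    [FiniteDimensional ℝ V] [MeasurableSpace V] [BorelSpace V] {B : Set V} (hBo : IsOpen B)
    (hBb : Bornology.IsBounded B) (hB0 : volume B ≠ 0) :
    ∃ φ : ℕ → V → ℝ, (∀ j, ContDiff ℝ (⊤ : ℕ∞) (φ j)) ∧ (∀ j, HasCompactSupport (φ j)) ∧
      (∀ j, ∀ t ∉ B, φ j t = 0) ∧ (∀ j t, φ j t ∈ Set.Icc 0 1) ∧
      Tendsto (fun j => ⨍ t in B, φ j t) atTop (𝓝 1) := by
  -- `B` is an increasing union of closed sets `F j`; `φ j` is `1` on `F j` and `0` off `B`, so it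
  -- is eventually `1` at each point of `B`.
  obtain ⟨F, hFc, hFB, hFU, hFm⟩ := hBo.exists_iUnion_isClosed
  have hex (j : ℕ) := exists_contMDiffMap_zero_one_of_isClosed (n := (⊤ : ℕ∞))
    (modelWithCornersSelf ℝ V) hBo.isClosed_compl (hFc j)
    (Set.disjoint_left.2 fun x hx hx' => hx (hFB j hx'))
  choose φ h0 h1 h01 using hex
  have hBt : volume B ≠ ⊤ := hBb.measure_lt_top.ne
  refine ⟨fun j => φ j, fun j => (φ j).contMDiff.contDiff, fun j => ?_, fun j t ht => h0 j ht, h01,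
    ?_⟩
  · refine HasCompactSupport.intro hBb.isCompact_closure fun t ht => h0 j ?_
    exact fun h => ht (subset_closure h)
  · have hlim : Tendsto (fun j => ∫ t in B, φ j t) atTop (𝓝 (∫ _ in B, (1 : ℝ))) := by
      refine tendsto_integral_of_dominated_convergence (fun _ => 1)
        (fun j => (φ j).contMDiff.continuous.aestronglyMeasurable)
        (integrableOn_const hBt) (fun j => ae_of_all _ fun t => ?_) ?_
      · rw [Real.norm_of_nonneg (h01 j t).1]
        exact (h01 j t).2
      · filter_upwards [ae_restrict_mem hBo.measurableSet] with t ht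
        obtain ⟨j, hj⟩ := Set.mem_iUnion.1 (hFU.symm ▸ ht)
        exact tendsto_atTop_of_eventually_const (i₀ := j) fun i hi => h1 i (hFm hi hj)
    have hB : volume.real B ≠ 0 := by
      simp [measureReal_def, ENNReal.toReal_eq_zero_iff, hB0, hBt]
    have h := hlim.const_smul (volume.real B)⁻¹
    simp only [← setAverage_eq] at h
    rwa [setAverage_const hB0 hBt] at h

variable {n k : ℕ} {s : ℝ}

theorem dilate_tensor {ℓ : ℝ} (hℓ : 0 < ℓ) (u : L2 (E n)) {φ : E k → ℝ} (hφ : MemLp φ 2 volume)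
    (hφℓ : MemLp (fun t => φ (ℓ⁻¹ • t)) 2 volume) :
    dilate hℓ (tensor u (hφ.toLp φ)) = tensor u (hφℓ.toLp _) := by
  refine Lp.ext ?_
  let L : EE n k ≃ₗ[ℝ] EE n k :=
    (WithLp.linearEquiv 2 ℝ (E n × E k)).trans
      (((LinearEquiv.refl ℝ (E n)).prodCongr
        (LinearEquiv.smulOfNeZero ℝ (E k) ℓ⁻¹ (inv_ne_zero hℓ.ne'))).trans
        (WithLp.linearEquiv 2 ℝ (E n × E k)).symm)
  -- The dilation preserves null sets, so almost-everywhere identities may be evaluated at dilated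
  -- points.
  have hL : Measure.QuasiMeasurePreserving (fun z : EE n k => L z) volume volume :=
    Measure.LinearMap.quasiMeasurePreserving volume (f := L.toLinearMap) L.isUnit_det'.ne_zero
  filter_upwards [(memLp_dilate hℓ (tensor u (hφ.toLp φ))).coeFn_toLp,
    coeFn_tensor u (hφℓ.toLp _), quasiMeasurePreserving_snd.ae hφℓ.coeFn_toLp,
    hL.ae (coeFn_tensor u (hφ.toLp φ)),
    hL.ae (quasiMeasurePreserving_snd.ae hφ.coeFn_toLp)] with z h1 h2 h3 h4 h5
  rw [dilate, h1, h2, h3]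
  refine h4.trans ?_
  rw [h5]
  rfl

/-- As `0 ≤ φ ≤ 1` vanishes off `B`, the dilated cutoff has squared norm at most `|ℓB|`, which
leaves `𝓔(u)` with constant one. In the other term the powers `ℓ^k` cancel and `ℓ^(-2s)` remains. -/
theorem rescaledEnergy_tensor_le (hs0 : 0 ≤ s) (hs1 : s ≤ 1) {B : Set (E k)}
    (hB : MeasurableSet B) (hB0 : volume B ≠ 0) (hBt : volume B ≠ ⊤) {φ : E k → ℝ}
    (hφ1 : Integrable φ) (hφ : MemLp φ 2 volume) (hφB : ∀ t ∉ B, φ t = 0)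
    (h01 : ∀ t, φ t ∈ Set.Icc 0 1) {ℓ : ℝ} (hℓ : 0 < ℓ) (u : L2 (E n)) :
    rescaledEnergy s B hℓ (tensor u (hφ.toLp φ)) ≤ energy s u +
      ENNReal.ofReal (ℓ ^ (-(2 * s))) *
        ((volume B)⁻¹ * (‖u‖ₑ ^ 2 * energy s (hφ.toLp φ))) := by
  have hvol : volume (ℓ • B) = ENNReal.ofReal (ℓ ^ Module.finrank ℝ (E k)) * volume B := by
    rw [Measure.addHaar_smul, abs_of_pos (pow_pos hℓ _)]
  set c := ENNReal.ofReal (ℓ ^ Module.finrank ℝ (E k)) with hc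
  have hc0 : c ≠ 0 := (ENNReal.ofReal_pos.2 (pow_pos hℓ _)).ne'
  have hct : c ≠ ⊤ := ENNReal.ofReal_ne_top
  have hℓB : MeasurableSet (ℓ • B) := hB.const_smul₀ ℓ
  have hv0 : volume (ℓ • B) ≠ 0 := by rw [hvol]; exact mul_ne_zero hc0 hB0
  have hvt : volume (ℓ • B) ≠ ⊤ := by rw [hvol]; exact ENNReal.mul_ne_top hct hBt
  have hle (t : E k) : ‖φ (ℓ⁻¹ • t)‖ₑ ^ 2 ≤ (ℓ • B).indicator (fun _ => 1) t := by
    by_cases ht : t ∈ ℓ • B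
    · rw [Set.indicator_of_mem ht, Real.enorm_eq_ofReal (h01 _).1]
      exact pow_le_one₀ zero_le (ENNReal.ofReal_le_one.2 (h01 _).2)
    · rw [Set.mem_smul_set_iff_inv_smul_mem₀ hℓ.ne'] at ht
      simp [hφB _ ht]
  have hn : eLpNorm (fun t => φ (ℓ⁻¹ • t)) 2 volume ^ 2 ≤ volume (ℓ • B) := by
    rw [eLpNorm_two_sq]
    refine (lintegral_mono hle).trans_eq ?_
    rw [lintegral_indicator_const hℓB, one_mul]
  have hφℓ : MemLp (fun t => φ (ℓ⁻¹ • t)) 2 volume := by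
    refine ⟨(hφ1.comp_smul (inv_ne_zero hℓ.ne')).aestronglyMeasurable, ?_⟩
    simpa using hn.trans_lt hvt.lt_top
  rw [rescaledEnergy, dilate_tensor hℓ u hφ hφℓ]
  refine (mul_le_mul_right (energy_tensor_le hs0 hs1 u (hφℓ.toLp _)) _).trans ?_
  rw [mul_add, energy_comp_inv_smul hφ1 hφ hℓ hφℓ, ← hc, Lp.enorm_toLp]
  refine add_le_add ?_ (le_of_eq ?_)
  · calc (volume (ℓ • B))⁻¹ * (energy s u * _)
        ≤ (volume (ℓ • B))⁻¹ * (energy s u * volume (ℓ • B)) := by gcongr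
      _ = energy s u := by
        rw [mul_left_comm, ENNReal.inv_mul_cancel hv0 hvt, mul_one]
  · rw [hvol, ENNReal.mul_inv (Or.inl hc0) (Or.inl hct)]
    calc _ = c⁻¹ * c * (ENNReal.ofReal (ℓ ^ (-(2 * s))) *
        ((volume B)⁻¹ * (‖u‖ₑ ^ 2 * energy s (hφ.toLp φ)))) := by ring
      _ = _ := by rw [ENNReal.inv_mul_cancel hc0 hct, one_mul]

theorem tensor_mem_tildeHSub (hs0 : 0 ≤ s) (hs1 : s ≤ 1) {ω : Set (E n)} {B : Set (E k)}
    {u : L2 (E n)} (hu : u ∈ tildeHSub s ω) {φ : E k → ℝ} (hφ : MemLp φ 2 volume)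
    (hφE : energy s (hφ.toLp φ) < ⊤) (hφB : ∀ t ∉ B, φ t = 0) :
    tensor u (hφ.toLp φ) ∈ tildeHSub s (cyl ω B) := by
  refine ⟨(energy_tensor_le hs0 hs1 _ _).trans_lt (ENNReal.add_lt_top.2
    ⟨ENNReal.mul_lt_top hu.1 (ENNReal.pow_lt_top enorm_lt_top),
      ENNReal.mul_lt_top (ENNReal.pow_lt_top enorm_lt_top) hφE⟩), ?_⟩
  filter_upwards [coeFn_tensor u (hφ.toLp φ), quasiMeasurePreserving_fst.ae hu.2,
    quasiMeasurePreserving_snd.ae hφ.coeFn_toLp] with z h1 h2 h3 hz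
  rw [h1, h3]
  by_cases hx : z.fst ∈ closure ω
  · have ht : z.snd ∉ B := by
      intro ht
      refine hz ?_
      have hcont : Continuous fun x : E n => (WithLp.toLp 2 (x, z.snd) : EE n k) :=
        (WithLp.prod_continuous_toLp 2 (E n) (E k)).comp (continuous_id.prodMk continuous_const)
      exact map_mem_closure hcont hx fun x hx => ⟨hx, ht⟩
    rw [hφB _ ht, mul_zero]
  · rw [h2 hx, zero_mul]

theorem average_tensor (B : Set (E k)) (u : L2 (E n)) {φ : E k → ℝ} (hφ : MemLp φ 2 volume) :
    averageL2 B (tensor u (hφ.toLp φ)) = (⨍ t in B, φ t) • u := by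
  refine Lp.ext ?_
  filter_upwards [(memLp_average B (tensor u (hφ.toLp φ))).coeFn_toLp,
    ae_ae_of_ae_withLp_prod (coeFn_tensor u (hφ.toLp φ)),
    Lp.coeFn_smul (⨍ t in B, φ t) u] with x h1 h2 h3
  rw [averageL2, h1, h3, Pi.smul_apply, setAverage_eq, setAverage_eq]
  have h4 : ∀ᵐ t, tensor u (hφ.toLp φ) (WithLp.toLp 2 (x, t)) = u x * φ t := by
    filter_upwards [h2, hφ.coeFn_toLp] with t h5 h6
    rw [h5]
    exact congrArg (u x * ·) h6
  rw [integral_congr_ae (ae_restrict_of_ae h4), integral_const_mul]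
  simp only [smul_eq_mul]
  ring

end Recovery

/-- A diagonal choice: if `f h j → 0` as `h → ∞` for each `j`, there is `J h → ∞` such that
`f h (J h) → 0`. -/
theorem exists_tendsto_diagonal {f : ℕ → ℕ → ℝ≥0∞}
    (hf : ∀ j, Tendsto (fun h => f h j) atTop (𝓝 0)) :
    ∃ J : ℕ → ℕ, Tendsto J atTop atTop ∧ Tendsto (fun h => f h (J h)) atTop (𝓝 0) := by
  classical
  have hev (j : ℕ) : ∀ᶠ h in atTop, f h j ≤ ((j : ℝ≥0∞) + 1)⁻¹ :=
    (hf j).eventually_le_const (by simp)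
  -- `J h` is the largest admissible `j ≤ h`; every fixed `j` is admissible eventually, so `J → ∞`.
  set J : ℕ → ℕ := fun h => Nat.findGreatest (fun j => f h j ≤ ((j : ℝ≥0∞) + 1)⁻¹) h with hJ
  have hJt : Tendsto J atTop atTop := by
    refine tendsto_atTop.2 fun j => ?_
    filter_upwards [hev j, eventually_ge_atTop j] with h h1 h2
    exact Nat.le_findGreatest h2 h1
  refine ⟨J, hJt, ?_⟩
  -- `Nat.findGreatest` returns `0` when nothing is admissible, so the bound at `J h` is claimed
  -- only once `j = 0` is admissible.
  have hle : ∀ᶠ h in atTop, f h (J h) ≤ ((J h : ℝ≥0∞) + 1)⁻¹ := by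
    filter_upwards [hev 0] with h h1
    exact Nat.findGreatest_spec (P := fun j => f h j ≤ ((j : ℝ≥0∞) + 1)⁻¹) (Nat.zero_le h) h1
  have hlim : Tendsto (fun j : ℕ => ((j : ℝ≥0∞) + 1)⁻¹) atTop (𝓝 0) := by
    have := (ENNReal.tendsto_inv_nat_nhds_zero.comp (tendsto_add_atTop_nat 1))
    simpa [Function.comp_def] using this
  exact tendsto_of_tendsto_of_tendsto_of_le_of_le' tendsto_const_nhds (hlim.comp hJt)
    (Eventually.of_forall fun _ => zero_le) hle

/-! ### The Γ-limit -/

section GammaLimit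

variable {n k : ℕ} {s : ℝ} {ω : Set (E n)} {B : Set (E k)}

theorem energy_average_le_liminf_rescaledEnergy (hs : 0 ≤ s) (hB : MeasurableSet B)
    (hB0 : volume B ≠ 0) (hBt : volume B ≠ ⊤) {ℓ : ℕ → ℝ} (hℓ : ∀ h, 0 < ℓ h)
    {v : L2 (EE n k)} {w : ℕ → L2 (EE n k)}
    (hw : ∀ T : StrongDual ℝ (L2 (E n)),
      Tendsto (fun h => T (averageL2 B (w h))) atTop (𝓝 (T (averageL2 B v)))) :
    ((energy s (averageL2 B v) : ℝ≥0∞) : EReal) ≤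
      liminf (fun h => ((rescaledEnergy s B (hℓ h) (w h) : ℝ≥0∞) : EReal)) atTop :=
  (energy_le_liminf hs hw).trans (liminf_le_liminf (Eventually.of_forall fun h =>
    EReal.coe_ennreal_le_coe_ennreal_iff.2
      (energy_average_le_rescaledEnergy hs hB hB0 hBt (hℓ h) _)))

/-- `Γ`-convergence of the rescaled energies for the weak-averaged topology given by the dual of
`H̃ˢ(ω)` with the norm of `Hˢ`. -/
theorem isSeqGammaLimit_rescaledEnergy (hs0 : 0 < s) (hs1 : s ≤ 1) (hBo : IsOpen B)
    (hBb : Bornology.IsBounded B) (hBv : volume B ≠ 0) {ℓ : ℕ → ℝ} (hℓ : ∀ h, 0 < ℓ h)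
    (hℓt : Tendsto ℓ atTop atTop)
    (hρ : ∀ v : TildeH s (cyl ω B), averageL2 B v.toL2 ∈ tildeHSub s ω) :
    IsSeqGammaLimit
      (weakAveraged (Y := TildeH s ω) fun v : TildeH s (cyl ω B) =>
        TildeH.ofMem (hρ v))
      (fun h v => ((rescaledEnergy s B (hℓ h) v.toL2 : ℝ≥0∞) : EReal))
      (fun v => ((energy s (averageL2 B v.toL2) : ℝ≥0∞) : EReal)) := by
  have hBt : volume B ≠ ⊤ := hBb.measure_lt_top.ne
  have hBm := hBo.measurableSet
  refine ⟨fun v w hw => ?_, fun v => ?_⟩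
  · exact energy_average_le_liminf_rescaledEnergy hs0.le hBm hBv hBt hℓ fun T =>
      -- A functional continuous on `L²` restricts to one continuous for the stronger norm of `Hˢ`.
      tendsto_nhds_weakAveraged_iff.1 hw
        (T.comp ((tildeHSub s ω).subtypeL.comp (TildeH.toSubmodule s ω)))
  · obtain ⟨φ, hφs, hφc, hφB, h01, hφ⟩ := exists_cutoff hBo hBb hBv
    set u := averageL2 B v.toL2 with hu
    have hφ1 (j : ℕ) : Integrable (φ j) :=
      (hφs j).continuous.integrable_of_hasCompactSupport (hφc j)
    have hφ2 (j : ℕ) : MemLp (φ j) 2 volume :=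
      (hφs j).continuous.memLp_of_hasCompactSupport (hφc j)
    have hφE (j : ℕ) := energy_toLp_lt_top hs0.le hs1 (hφc j) (hφs j) (hφ2 j)
    have hD (j : ℕ) : (volume B)⁻¹ * (‖u‖ₑ ^ 2 * energy s ((hφ2 j).toLp (φ j))) ≠ ⊤ :=
      ENNReal.mul_ne_top (ENNReal.inv_ne_top.2 hBv) (ENNReal.mul_ne_top (by simp) (hφE j).ne)
    have hpow : Tendsto (fun h => ENNReal.ofReal (ℓ h ^ (-(2 * s)))) atTop (𝓝 0) := by
      have h := (tendsto_rpow_neg_atTop (y := 2 * s) (by positivity)).comp hℓt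
      simpa using ENNReal.tendsto_ofReal h
    obtain ⟨J, hJ, hJ0⟩ := exists_tendsto_diagonal
      (f := fun h j => ENNReal.ofReal (ℓ h ^ (-(2 * s))) *
        ((volume B)⁻¹ * (‖u‖ₑ ^ 2 * energy s ((hφ2 j).toLp (φ j))))) fun j => by
          simpa using ENNReal.Tendsto.mul_const hpow (Or.inr (hD j))
    refine ⟨fun h => TildeH.ofMem (u := tensor u ((hφ2 (J h)).toLp (φ (J h))))
      (tensor_mem_tildeHSub hs0.le hs1 (hρ v) (hφ2 _) (hφE _) (hφB _)), ?_, ?_⟩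
    · refine tendsto_nhds_weakAveraged_iff.2 fun T => ?_
      -- The averages are multiples of `u` with scalars tending to `1`, so each `T` is tested along
      -- one line only.
      have h1 := (hφ.comp hJ).mul_const (T (TildeH.ofMem (hρ v)))
      rw [one_mul] at h1
      refine h1.congr fun h => ?_
      rw [Function.comp_apply, ← smul_eq_mul, ← map_smul]
      exact congrArg T (Subtype.ext (average_tensor B u (hφ2 (J h))).symm)
    · have h1 := hJ0.const_add (energy s u)
      rw [add_zero] at h1
      have h2 := ((continuous_coe_ennreal_ereal.tendsto _).comp h1).limsup_eq
      refine le_trans (limsup_le_limsup (Eventually.of_forall fun h => ?_)) h2.le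
      exact EReal.coe_ennreal_le_coe_ennreal_iff.2 (rescaledEnergy_tensor_le hs0.le hs1 hBm hBv
        hBt (hφ1 _) (hφ2 _) (hφB _) (h01 _) (hℓ h) u)

end GammaLimit

end FracDim

end

open FracDim in
/-- The averaging operator `ρ` maps `H̃ˢ(ω × B)` into `H̃ˢ(ω)`, and for the resulting weak-averaged
topology `σ_ρ` on `H̃ˢ(ω × B)` the energies `𝓔_ℓ` `Γ`-converge to `𝓔ˢ ∘ ρ` along every sequence
`ℓ → ∞`. -/
theorem theorem4 (n k : ℕ) (hn : 1 ≤ n) (hk : 1 ≤ k) (s : ℝ) (hs0 : 0 < s) (hs1 : s < 1)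
    (ω : Set (E n)) (hω : IsLipschitzDomain ω) (hωb : Bornology.IsBounded ω)
    (B : Set (E k)) (hBo : IsOpen B) (hBc : Convex ℝ B) (hBb : Bornology.IsBounded B)
    (hB0 : (0 : E k) ∈ B)
    (ℓ : ℕ → ℝ) (hℓ : ∀ h, 0 < ℓ h) (hℓt : Filter.Tendsto ℓ Filter.atTop Filter.atTop) :
    ∃ hρ : ∀ v : TildeH s (cyl ω B), averageL2 B v.toL2 ∈ tildeHSub s ω,
      IsSeqGammaLimit
        (weakAveraged fun v : TildeH s (cyl ω B) => (⟨averageL2 B v.toL2, hρ v⟩ : TildeH s ω))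
        (fun h v => ((rescaledEnergy s B (hℓ h) v.toL2 : ENNReal) : EReal))
        (fun v => ((energy s (averageL2 B v.toL2) : ENNReal) : EReal)) := by
  have hBv : volume B ≠ 0 := (hBo.measure_pos volume ⟨0, hB0⟩).ne'
  have hBt : volume B ≠ ⊤ := hBb.measure_lt_top.ne
  have hBm := hBo.measurableSet
  have hρ (v : TildeH s (cyl ω B)) := average_mem_tildeHSub hs0.le hBm hBv hBt v
  refine ⟨hρ, fun v w hw => ?_, fun v => ?_⟩
  -- In this topology the values of `ρ` lie in the subtype `tildeHSub s ω`, which carries the norm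
  -- of `L²`, so restrictions of `L²` functionals are admissible tests.
  · exact energy_average_le_liminf_rescaledEnergy hs0.le hBm hBv hBt hℓ fun T =>
      tendsto_nhds_weakAveraged_iff.1 hw (T.comp (tildeHSub s ω).subtypeL)
  · obtain ⟨w, hw, hwE⟩ :=
      (isSeqGammaLimit_rescaledEnergy hs0 hs1.le hBo hBb hBv hℓ hℓt hρ).2 v
    -- A functional continuous for the `L²` norm is continuous for that of `Hˢ`, so the same
    -- recovery sequence serves.
    exact ⟨w, tendsto_nhds_weakAveraged_iff.2 fun T =>
      tendsto_nhds_weakAveraged_iff.1 hw (T.comp (TildeH.toSubmodule s ω)), hwE⟩
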